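/- Let $n\ge 2$, let $\kappa,M,\lambda\in\mathbb R$ with $M\neq 0$, and put $f(r)=\kappa-\frac{2M}{r^{n-1}}-\lambda r^2$ and $\Lambda=\frac{n(n+1)}{2}\lambda$. Let $(K,\widehat g)$ be an $n$-dimensional smooth Riemannian manifold that is an Einstein space, $\widehat R_{MN}=\kappa(n-1)\widehat g_{MN}$ (for instance a space of constant curvature $\kappa$). Let $U\subset\mathbb R^2$ be an open set of pairs $(t,r)$ on which $r>0$ and $f(r)>0$, and consider the $(n+2)$-dimensional static spacetime $U\times K$ with the metric $$g=-f(r)\,dt^2+\frac{dr^2}{f(r)}+r^2\,\widehat g ,$$ with Levi-Civita connection $\nabla$, wave operator $\Box=g^{\alpha\beta}\nabla_\alpha\nabla_\beta$ and Weyl tensor $C_{\alpha\beta\gamma\delta}$ (with curvature signs such that $R_{\alpha\beta\gamma\delta}=c(g_{\alpha\gamma}g_{\beta\delta}-g_{\alpha\delta}g_{\beta\gamma})$ in constant curvature $c$). Let $$\ell=\frac{1}{\sqrt{2f}}(\partial_t+f\partial_r),\qquad k=\frac{1}{\sqrt{2f}}(-\partial_t+f\partial_r)$$ be the null vector fields of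 the frame, normalized by $\ell^\alpha k_\alpha=1$, and let $m_i$ ($i=2,\dots,n+1$) be orthonormal vectors orthogonal to $\ell$ and $k$. Set $$\rho=\sum_i m_i^\alpha m_i^\beta\nabla_\beta\ell_\alpha,\quad \rho'=\sum_i m_i^\alpha m_i^\beta\nabla_\beta k_\alpha,\quad \tau_i=m_i^\alpha k^\beta\nabla_\beta\ell_\alpha,\quad \gamma_\alpha=\tfrac{\rho}{n}k_\alpha+\tfrac{\rho'}{n}\ell_\alpha-\sum_i\tau_i (m_i)_\alpha ,$$ $$\Phi=C_{\alpha\beta\gamma\delta}\,\ell^\alpha k^\beta\ell^\gamma k^\delta,\qquad q=-\frac{1}{n+1},\qquad Z_{\alpha\beta}=2\Phi^q\,\ell_{[\alpha}k_{\beta]}=\Phi^q(\ell_\alpha k_\beta-k_\alpha\ell_\beta),$$ where $\Phi^q$ is the principal value of the power, complex where $\Phi<0$. (Both sides of the identity below are linear in $Z$, so a constant factor in $Z$ is immaterial.) For a 1-form $J$, a 2-form $F$, a 3-form $H$ and a number $\mathfrak s$ let $$(\mathscr D_{\mathfrak s}J)_{\alpha\beta}=2(\nabla_{[\alpha}+2\mathfrak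 s\gamma_{[\alpha})J_{\beta]},\qquad (\mathscr D_{\mathfrak s}F)_{\alpha\beta\delta}=3(\nabla_{[\alpha}+2\mathfrak s\gamma_{[\alpha})F_{\beta\delta]},$$ $$(\mathscr D^\star_{\mathfrak s}F)_{\beta}=-(\nabla^\alpha+2\mathfrak s\gamma^\alpha)F_{\alpha\beta},\qquad (\mathscr D^\star_{\mathfrak s}H)_{\beta\delta}=-(\nabla^\alpha+2\mathfrak s\gamma^\alpha)H_{\alpha\beta\delta},$$ and $\mathscr D=\mathscr D_0$, $\mathscr D^\star=\mathscr D^\star_0$. Then for every real or complex valued 2-form $F$ of class $C^2$ on $U\times K$ (no field equation is assumed), $$-Z^{\alpha\beta}\big[(\mathscr D_1\mathscr D^\star+\mathscr D^\star_1\mathscr D)F\big]_{\alpha\beta}=(\Box+V^+)\big[Z^{\alpha\beta}F_{\alpha\beta}\big],\qquad V^+=-\frac{2(n-1)}{n}\Big[\Phi+\frac{2\Lambda}{n+1}\Big],$$ at every point of $U\times K$. -/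

import Mathlib

open scoped Manifold ContDiff
open Bundle

noncomputable section

namespace StaticBH

/-! ### Tensor calculus in a coordinate patch

`ι` indexes the coordinates, a point of the patch is `x : ι → ℝ`, a metric is the field `g` of its
component matrices `g x a b`. Tensor components take values in a real normed space `V` (`ℝ` or
`ℂ`). -/

section Calculus

variable {ι : Type*} [Fintype ι] [DecidableEq ι] {V : Type*} [NormedAddCommGroup V]
  [NormedSpace ℝ V]

/-- The coordinate derivative `∂_a`. -/
def pd (a : ι) (h : (ι → ℝ) → V) (x : ι → ℝ) : V := fderiv ℝ h x (Pi.single a 1)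

/-- The inverse metric `g^{ab}`. -/
def invMetric (g : (ι → ℝ) → Matrix ι ι ℝ) (x : ι → ℝ) : Matrix ι ι ℝ := (g x)⁻¹

/-- The Christoffel symbols `Γ^c_{ab}` of the Levi-Civita connection. -/
def christoffel (g : (ι → ℝ) → Matrix ι ι ℝ) (x : ι → ℝ) (c a b : ι) : ℝ :=
  (1 / 2) * ∑ e, invMetric g x c e *
    (pd a (fun z => g z e b) x + pd b (fun z => g z e a) x - pd e (fun z => g z a b) x)

/-- The Riemann tensor `R^a_{bcd}`, positive on round spheres:
`R_{abcd} = k (g_{ac} g_{bd} - g_{ad} g_{bc})` in constant curvature `k`. -/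
def riemannUp (g : (ι → ℝ) → Matrix ι ι ℝ) (x : ι → ℝ) (a b c d : ι) : ℝ :=
  pd c (fun z => christoffel g z a d b) x - pd d (fun z => christoffel g z a c b) x
    + ∑ e, (christoffel g x a c e * christoffel g x e d b
      - christoffel g x a d e * christoffel g x e c b)

/-- `R_{abcd}`. -/
def riemann (g : (ι → ℝ) → Matrix ι ι ℝ) (x : ι → ℝ) (a b c d : ι) : ℝ :=
  ∑ e, g x a e * riemannUp g x e b c d

/-- The Ricci tensor `R_{ab} = R^c_{acb}`. -/
def ricci (g : (ι → ℝ) → Matrix ι ι ℝ) (x : ι → ℝ) (a b : ι) : ℝ :=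
  ∑ c, riemannUp g x c a c b

/-- The scalar curvature. -/
def scalarCurv (g : (ι → ℝ) → Matrix ι ι ℝ) (x : ι → ℝ) : ℝ :=
  ∑ a, ∑ b, invMetric g x a b * ricci g x a b

/-- The Weyl tensor `C_{abcd}`, in dimension `d = card ι ≥ 3`. -/
def weyl (g : (ι → ℝ) → Matrix ι ι ℝ) (x : ι → ℝ) (a b c d : ι) : ℝ :=
  riemann g x a b c d
    - (1 / ((Fintype.card ι : ℝ) - 2)) *
      (g x a c * ricci g x b d - g x a d * ricci g x b c
        - g x b c * ricci g x a d + g x b d * ricci g x a c)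
    + (scalarCurv g x / (((Fintype.card ι : ℝ) - 1) * ((Fintype.card ι : ℝ) - 2))) *
      (g x a c * g x b d - g x a d * g x b c)

/-- `∇_a w_b`. -/
def nabla₁ (g : (ι → ℝ) → Matrix ι ι ℝ) (w : (ι → ℝ) → ι → V) (x : ι → ℝ) (a b : ι) : V :=
  pd a (fun z => w z b) x - ∑ e, christoffel g x e a b • w x e

/-- `∇_a T_{bc}`. -/
def nabla₂ (g : (ι → ℝ) → Matrix ι ι ℝ) (T : (ι → ℝ) → ι → ι → V) (x : ι → ℝ)
    (a b c : ι) : V :=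
  pd a (fun z => T z b c) x
    - ∑ e, (christoffel g x e a b • T x e c + christoffel g x e a c • T x b e)

/-- `∇_a T_{bcd}`. -/
def nabla₃ (g : (ι → ℝ) → Matrix ι ι ℝ) (T : (ι → ℝ) → ι → ι → ι → V) (x : ι → ℝ)
    (a b c d : ι) : V :=
  pd a (fun z => T z b c d) x
    - ∑ e, (christoffel g x e a b • T x e c d + christoffel g x e a c • T x b e d
      + christoffel g x e a d • T x b c e)

/-- The wave operator `□ = g^{ab} ∇_a ∇_b` on scalar functions. -/
def box (g : (ι → ℝ) → Matrix ι ι ℝ) (h : (ι → ℝ) → V) (x : ι → ℝ) : V :=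
  ∑ a, ∑ b, invMetric g x a b • nabla₁ g (fun z c => pd c h z) x a b

/-- `(D_s w)_{ab} = 2 (∇_{[a} + 2 s γ_{[a}) w_{b]}` on 1-forms. -/
def extD₁ (s : ℝ) (g : (ι → ℝ) → Matrix ι ι ℝ) (γ : (ι → ℝ) → ι → ℝ)
    (w : (ι → ℝ) → ι → V) (x : ι → ℝ) (a b : ι) : V :=
  (nabla₁ g w x a b + (2 * s * γ x a) • w x b) - (nabla₁ g w x b a + (2 * s * γ x b) • w x a)

/-- `(D_s w)_{abc} = 3 (∇_{[a} + 2 s γ_{[a}) w_{bc]}` on 2-forms; as `w` is antisymmetric, this is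
the sum over the cyclic permutations of `a, b, c`. -/
def extD₂ (s : ℝ) (g : (ι → ℝ) → Matrix ι ι ℝ) (γ : (ι → ℝ) → ι → ℝ)
    (w : (ι → ℝ) → ι → ι → V) (x : ι → ℝ) (a b c : ι) : V :=
  (nabla₂ g w x a b c + (2 * s * γ x a) • w x b c)
    + (nabla₂ g w x b c a + (2 * s * γ x b) • w x c a)
    + (nabla₂ g w x c a b + (2 * s * γ x c) • w x a b)

/-- `(D⋆_s w)_b = -(∇^a + 2 s γ^a) w_{ab}` on 2-forms. -/
def coD₂ (s : ℝ) (g : (ι → ℝ) → Matrix ι ι ℝ) (γ : (ι → ℝ) → ι → ℝ)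
    (w : (ι → ℝ) → ι → ι → V) (x : ι → ℝ) (b : ι) : V :=
  -∑ a, ∑ e, invMetric g x a e • (nabla₂ g w x e a b + (2 * s * γ x e) • w x a b)

/-- `(D⋆_s w)_{bc} = -(∇^a + 2 s γ^a) w_{abc}` on 3-forms. -/
def coD₃ (s : ℝ) (g : (ι → ℝ) → Matrix ι ι ℝ) (γ : (ι → ℝ) → ι → ℝ)
    (w : (ι → ℝ) → ι → ι → ι → V) (x : ι → ℝ) (b c : ι) : V :=
  -∑ a, ∑ e, invMetric g x a e • (nabla₃ g w x e a b c + (2 * s * γ x e) • w x a b c)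

/-- The spin `s` modified Laplace-de Rham operator `D_s D⋆ + D⋆_s D` on 2-forms, where
`D = D_0` and `D⋆ = D⋆_0`. -/
def modLaplaceDeRham (s : ℝ) (g : (ι → ℝ) → Matrix ι ι ℝ) (γ : (ι → ℝ) → ι → ℝ)
    (w : (ι → ℝ) → ι → ι → V) (x : ι → ℝ) (a b : ι) : V :=
  extD₁ s g γ (coD₂ 0 g γ w) x a b + coD₃ s g γ (extD₂ 0 g γ w) x a b

/-- The full contraction `A^{ab} B_{ab} = g^{ac} g^{bd} A_{cd} B_{ab}`. -/
def contract (g : (ι → ℝ) → Matrix ι ι ℝ) (A B : (ι → ℝ) → ι → ι → ℂ) (x : ι → ℝ) : ℂ :=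
  ∑ a, ∑ b, ∑ c, ∑ d,
    ((invMetric g x a c * invMetric g x b d : ℝ) : ℂ) * A x c d * B x a b

/-- `v_a = g_{ab} v^b`. -/
def lower (g : (ι → ℝ) → Matrix ι ι ℝ) (v : (ι → ℝ) → ι → ℝ) (x : ι → ℝ) (a : ι) : ℝ :=
  ∑ b, g x a b * v x b

/-! ### Quantities attached to a pair of null vectors `ℓ`, `k` with `ℓ · k = 1`

(`k` is the vector usually called `n`.) If `m_i` are orthonormal vectors completing `ℓ, k` to a
frame, then `g^{ab} = ℓ^a k^b + k^a ℓ^b + ∑ i, m_i^a m_i^b`, so sums over `i` can be written with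
the projector `h^{ab} = ∑ i, m_i^a m_i^b`. -/

/-- `h^{ab} = ∑ i, m_i^a m_i^b = g^{ab} - ℓ^a k^b - k^a ℓ^b`. -/
def screen (g : (ι → ℝ) → Matrix ι ι ℝ) (l k : (ι → ℝ) → ι → ℝ) (x : ι → ℝ) (a b : ι) : ℝ :=
  invMetric g x a b - l x a * k x b - k x a * l x b

/-- The expansion `∑ i, m_i^a m_i^b ∇_b v_a`, for `v = ℓ` (giving `ρ`) or `v = k` (giving `ρ'`). -/
def expansion (g : (ι → ℝ) → Matrix ι ι ℝ) (l k v : (ι → ℝ) → ι → ℝ) (x : ι → ℝ) : ℝ :=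
  ∑ a, ∑ b, screen g l k x a b * nabla₁ g (lower g v) x b a

/-- The 1-form `∑ i, τ_i m^i_a`, where `τ_i = m_i^b k^c ∇_c ℓ_b`. -/
def tauForm (g : (ι → ℝ) → Matrix ι ι ℝ) (l k : (ι → ℝ) → ι → ℝ) (x : ι → ℝ) (a : ι) : ℝ :=
  ∑ e, g x a e * ∑ b, screen g l k x e b * ∑ c, k x c * nabla₁ g (lower g l) x c b

/-- The 1-form `γ_a = ρ/(d-2) k_a + ρ'/(d-2) ℓ_a - τ_i m^i_a`. -/
def gammaForm (g : (ι → ℝ) → Matrix ι ι ℝ) (l k : (ι → ℝ) → ι → ℝ) (x : ι → ℝ) (a : ι) : ℝ :=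
  expansion g l k l x / ((Fintype.card ι : ℝ) - 2) * lower g k x a
    + expansion g l k k x / ((Fintype.card ι : ℝ) - 2) * lower g l x a
    - tauForm g l k x a

/-- The Weyl scalar `Φ = C_{0101} = C_{abcd} ℓ^a k^b ℓ^c k^d`. -/
def weylScalar (g : (ι → ℝ) → Matrix ι ι ℝ) (l k : (ι → ℝ) → ι → ℝ) (x : ι → ℝ) : ℝ :=
  ∑ a, ∑ b, ∑ c, ∑ d, weyl g x a b c d * l x a * k x b * l x c * k x d

/-- `Z_{ab} = 2 Φ^q ℓ_{[a} k_{b]} = Φ^q (ℓ_a k_b - k_a ℓ_b)` with `q = -1/(d-1)`; as `Φ` may be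
negative, `Φ^q` is the principal value of the complex power. -/
def ckyForm (g : (ι → ℝ) → Matrix ι ι ℝ) (l k : (ι → ℝ) → ι → ℝ) (x : ι → ℝ) (a b : ι) : ℂ :=
  ((weylScalar g l k x : ℝ) : ℂ) ^ (-1 / ((Fintype.card ι : ℂ) - 1)) *
    ((lower g l x a * lower g k x b - lower g k x a * lower g l x b : ℝ) : ℂ)

end Calculus

/-! ### The static black hole spacetime -/

/-- `f(r) = κ - 2M / r^{n-1} - λ r²`. -/
def lapse (n : ℕ) (κ M lam r : ℝ) : ℝ := κ - 2 * M / r ^ (n - 1) - lam * r ^ 2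

/-- `Λ = n(n+1)λ/2`. -/
def cosmConst (n : ℕ) (lam : ℝ) : ℝ := (n : ℝ) * (n + 1) / 2 * lam

/-- Coordinate indices: `inl 0` is `t`, `inl 1` is `r`, `inr i` are coordinates on `K`. -/
abbrev Idx (n : ℕ) : Type := Fin 2 ⊕ Fin n

section Manifold

variable {n : ℕ} {K : Type*} [TopologicalSpace K] [ChartedSpace (EuclideanSpace ℝ (Fin n)) K]

/-- The tangent space of `ℝ × ℝ × K` at `p = (t, r, y)`. -/
abbrev STangent (n : ℕ) {K : Type*} [TopologicalSpace K]
    [ChartedSpace (EuclideanSpace ℝ (Fin n)) K] (p : ℝ × ℝ × K) : Type := ℝ × ℝ × TangentSpace (𝓡 n) p.2.2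

/-- A smooth Riemannian metric on `K`. -/
abbrev RMetric (n : ℕ) (K : Type*) [TopologicalSpace K]
    [ChartedSpace (EuclideanSpace ℝ (Fin n)) K] [IsManifold (𝓡 n) ∞ K] :=
  ContMDiffRiemannianMetric (𝓡 n) ∞ (EuclideanSpace ℝ (Fin n))
    (fun y : K => TangentSpace (𝓡 n) y)

/-- The point of `K` with coordinates `y` in the chart `φ`. -/
def kPoint (φ : OpenPartialHomeomorph K (EuclideanSpace ℝ (Fin n))) (y : Fin n → ℝ) : K :=
  φ.symm (WithLp.toLp 2 y)

/-- The coordinate vector `∂_i` of the chart `φ` of `K`. -/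
def kVec (φ : OpenPartialHomeomorph K (EuclideanSpace ℝ (Fin n))) (y : Fin n → ℝ) (i : Fin n) :
    TangentSpace (𝓡 n) (kPoint φ y) :=
  mfderiv (𝓡 n) (𝓡 n) φ.symm (WithLp.toLp 2 y) (EuclideanSpace.single i (1 : ℝ))

/-- The point of `ℝ × ℝ × K` with coordinates `x` in the chart induced by `φ`. -/
def sPoint (φ : OpenPartialHomeomorph K (EuclideanSpace ℝ (Fin n))) (x : Idx n → ℝ) :
    ℝ × ℝ × K :=
  (x (Sum.inl 0), x (Sum.inl 1), kPoint φ (fun i => x (Sum.inr i)))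

/-- The coordinate vectors `∂_t, ∂_r, ∂_i` of the chart of `ℝ × ℝ × K` induced by `φ`. -/
def sVec (φ : OpenPartialHomeomorph K (EuclideanSpace ℝ (Fin n))) (x : Idx n → ℝ) :
    Idx n → STangent n (sPoint φ x)
  | Sum.inl 0 => (1, 0, 0)
  | Sum.inl 1 => (0, 1, 0)
  | Sum.inr i => (0, 0, kVec φ (fun j => x (Sum.inr j)) i)

/-- Coordinates of the points `(t, r, y)` with `(t, r) ∈ U` and `y` in the domain of `φ`. -/
def region (U : Set (ℝ × ℝ)) (φ : OpenPartialHomeomorph K (EuclideanSpace ℝ (Fin n))) :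
    Set (Idx n → ℝ) :=
  {x | (x (Sum.inl 0), x (Sum.inl 1)) ∈ U ∧
    (WithLp.toLp 2 (fun i => x (Sum.inr i)) : EuclideanSpace ℝ (Fin n)) ∈ φ.target}

/-- A (complex valued) field of alternating bilinear forms on `ℝ × ℝ × K`. -/
abbrev TwoForm (n : ℕ) (K : Type*) [TopologicalSpace K]
    [ChartedSpace (EuclideanSpace ℝ (Fin n)) K] :=
  (p : ℝ × ℝ × K) → (STangent n p) [⋀^Fin 2]→ₗ[ℝ] ℂ

/-- The components `F_{ab}` in the chart induced by `φ`. -/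
def TwoForm.comp (F : TwoForm n K) (φ : OpenPartialHomeomorph K (EuclideanSpace ℝ (Fin n)))
    (x : Idx n → ℝ) (a b : Idx n) : ℂ :=
  F (sPoint φ x) ![sVec φ x a, sVec φ x b]

variable [IsManifold (𝓡 n) ∞ K]

/-- `F` is of class `C²` over `U × K`. -/
def TwoForm.IsC2On (F : TwoForm n K) (U : Set (ℝ × ℝ)) : Prop :=
  ∀ φ ∈ IsManifold.maximalAtlas (𝓡 n) ∞ K, ∀ a b,
    ContDiffOn ℝ 2 (fun x => F.comp φ x a b) (region U φ)

/-- The components of the metric of `K` in the chart `φ`. -/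
def kMetric (gK : RMetric n K) (φ : OpenPartialHomeomorph K (EuclideanSpace ℝ (Fin n)))
    (y : Fin n → ℝ) : Matrix (Fin n) (Fin n) ℝ :=
  Matrix.of fun i j => gK.inner (kPoint φ y) (kVec φ y i) (kVec φ y j)

/-- `K` is an Einstein space with `Ric = c g`. -/
def IsEinstein (gK : RMetric n K) (c : ℝ) : Prop :=
  ∀ φ ∈ IsManifold.maximalAtlas (𝓡 n) ∞ K, ∀ y : Fin n → ℝ,
    (WithLp.toLp 2 y : EuclideanSpace ℝ (Fin n)) ∈ φ.target →
      ∀ i j, ricci (kMetric gK φ) y i j = c * kMetric gK φ y i j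

/-- The spacetime metric `-f(r) dt² + dr² / f(r) + r² gK` on `ℝ × ℝ × K`. -/
def spacetimeMetric (gK : RMetric n K) (f : ℝ → ℝ) (p : ℝ × ℝ × K) (u v : STangent n p) : ℝ :=
  -f p.2.1 * (u.1 * v.1) + 1 / f p.2.1 * (u.2.1 * v.2.1)
    + p.2.1 ^ 2 * gK.inner p.2.2 u.2.2 v.2.2

/-- The components of the spacetime metric in the chart induced by `φ`. -/
def sMetric (gK : RMetric n K) (f : ℝ → ℝ)
    (φ : OpenPartialHomeomorph K (EuclideanSpace ℝ (Fin n))) (x : Idx n → ℝ) :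
    Matrix (Idx n) (Idx n) ℝ :=
  Matrix.of fun a b => spacetimeMetric gK f (sPoint φ x) (sVec φ x a) (sVec φ x b)

end Manifold

/-- `ℓ = (2f)^{-1/2} (∂_t + f ∂_r)`, in the coordinates `(t, r, y)`. -/
def nullL {n : ℕ} (f : ℝ → ℝ) (x : Idx n → ℝ) : Idx n → ℝ
  | Sum.inl 0 => 1 / √(2 * f (x (Sum.inl 1)))
  | Sum.inl 1 => f (x (Sum.inl 1)) / √(2 * f (x (Sum.inl 1)))
  | Sum.inr _ => 0

/-- `k = (2f)^{-1/2} (-∂_t + f ∂_r)`, in the coordinates `(t, r, y)`. -/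
def nullK {n : ℕ} (f : ℝ → ℝ) (x : Idx n → ℝ) : Idx n → ℝ
  | Sum.inl 0 => -1 / √(2 * f (x (Sum.inl 1)))
  | Sum.inl 1 => f (x (Sum.inl 1)) / √(2 * f (x (Sum.inl 1)))
  | Sum.inr _ => 0

/-- `V⁺ = -(2(n-1)/n) (Φ + 2Λ/(n+1))`. -/
def potential (n : ℕ) (Φ Λ : ℝ) : ℝ :=
  -(2 * ((n : ℝ) - 1) / n) * (Φ + 2 * Λ / (n + 1))

end StaticBH

end

/-! The identity reduces to one scalar equation for the component `F_tr`, because the black hole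
data collapse to functions of `r`.

In a warped chart the covector `γ` is `dr / r` (`gammaForm_eq`), and `ℓ ∧ k` is `dr ∧ dt`
(`lower_wedge`). The Weyl scalar is `Φ = -n(n-1)M / r^(n+1)` (`weylScalar_lapse`). As `q =
-1/(n+1)`, the power `Φ^q` is a nonzero constant `Q` times `r`, even for the principal branch at
negative `Φ` (`ofReal_div_pow_cpow`). Contraction of an antisymmetric `B` with `Z` is therefore `2 Q
r B_tr` (`contract_ckyForm`), and the claim becomes `-r [(D_1 D⋆ + D⋆_1 D) F]_tr = (□ + (n-1) f'/r)
(r F_tr)`.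

This is `r_smul_modLaplaceDeRham_tr`, valid for every `C²` warping function `f > 0` and every metric
on `K`. With `φ = F_tr` and `div` the divergence on `K`, the codifferential has components `J_t = f
∂_r φ + (n f/r) φ + r⁻² div F_t·` and `J_r = f⁻¹ ∂_t φ + r⁻² div F_r·`. In `∂_t J_r - ∂_r J_t -
(2/r) J_t`, the derivative of `r⁻²` is cancelled by the term with `γ`; this is what spin 1 is for.
The remaining `div ∂_t F_r·` and `div ∂_r F_t·` cancel against `D⋆_1 D F`, as they would in the
ordinary Laplace-de Rham operator. What is left involves `φ` alone and is compared with `□ (r φ)`.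

The specific `f` and the Einstein condition enter only through `Φ`: they give its power law and `V⁺
= (n-1) f'/r`. -/

noncomputable section

namespace StaticBH

set_option linter.unusedSectionVars false

/-! ### Coordinate derivatives -/

section PartialDerivatives

variable {ι : Type*} [Fintype ι] [DecidableEq ι] {V : Type*} [NormedAddCommGroup V]
  [NormedSpace ℝ V]

theorem pd_congr {h h' : (ι → ℝ) → V} {x : ι → ℝ} (H : h =ᶠ[nhds x] h') (a : ι) :
    pd a h x = pd a h' x := by
  rw [pd, pd, H.fderiv_eq]

theorem pd_congr_on {S : Set (ι → ℝ)} (hS : IsOpen S) {h h' : (ι → ℝ) → V}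
    (H : ∀ z ∈ S, h z = h' z) {x : ι → ℝ} (hx : x ∈ S) (a : ι) : pd a h x = pd a h' x :=
  pd_congr (Filter.eventuallyEq_of_mem (hS.mem_nhds hx) H) a

@[simp] theorem pd_const (c : V) (x : ι → ℝ) (a : ι) : pd a (fun _ => c) x = 0 := by
  simp [pd]

theorem pd_add {h h' : (ι → ℝ) → V} {x : ι → ℝ} (H : DifferentiableAt ℝ h x)
    (H' : DifferentiableAt ℝ h' x) (a : ι) :
    pd a (fun z => h z + h' z) x = pd a h x + pd a h' x := by
  simp only [pd]; rw [fderiv_fun_add H H']; rfl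

theorem pd_sub {h h' : (ι → ℝ) → V} {x : ι → ℝ} (H : DifferentiableAt ℝ h x)
    (H' : DifferentiableAt ℝ h' x) (a : ι) :
    pd a (fun z => h z - h' z) x = pd a h x - pd a h' x := by
  simp only [pd]; rw [fderiv_fun_sub H H']; rfl

theorem pd_neg (h : (ι → ℝ) → V) (x : ι → ℝ) (a : ι) :
    pd a (fun z => -h z) x = -pd a h x := by
  simp only [pd]; rw [fderiv_fun_neg]; rfl

theorem pd_sum {σ : Type*} (s : Finset σ) {h : σ → (ι → ℝ) → V} {x : ι → ℝ}
    (H : ∀ i ∈ s, DifferentiableAt ℝ (h i) x) (a : ι) :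
    pd a (fun z => ∑ i ∈ s, h i z) x = ∑ i ∈ s, pd a (h i) x := by
  simp only [pd]; rw [fderiv_fun_sum H]; simp

theorem pd_smul {u : (ι → ℝ) → ℝ} {h : (ι → ℝ) → V} {x : ι → ℝ} (Hu : DifferentiableAt ℝ u x)
    (H : DifferentiableAt ℝ h x) (a : ι) :
    pd a (fun z => u z • h z) x = u x • pd a h x + pd a u x • h x := by
  simp only [pd]; rw [fderiv_fun_smul Hu H]; simp

theorem pd_const_mul {h : (ι → ℝ) → ℂ} {x : ι → ℝ} (c : ℂ) (H : DifferentiableAt ℝ h x) (a : ι) :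
    pd a (fun z => c * h z) x = c * pd a h x := by
  simp only [pd]; rw [fderiv_const_mul H]; simp

theorem contDiffAt_pd {m k : WithTop ℕ∞} {h : (ι → ℝ) → V} {x : ι → ℝ} (H : ContDiffAt ℝ k h x)
    (hm : m + 1 ≤ k) (a : ι) : ContDiffAt ℝ m (pd a h) x :=
  (H.fderiv_right hm).clm_apply contDiffAt_const

theorem differentiableAt_pd {h : (ι → ℝ) → V} {x : ι → ℝ} (H : ContDiffAt ℝ 2 h x) (a : ι) :
    DifferentiableAt ℝ (pd a h) x :=
  (contDiffAt_pd (m := 1) H (by norm_num) a).differentiableAt (by norm_num)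

theorem pd_comm {h : (ι → ℝ) → V} {x : ι → ℝ} (H : ContDiffAt ℝ 2 h x) (a b : ι) :
    pd a (pd b h) x = pd b (pd a h) x := by
  have hd : DifferentiableAt ℝ (fderiv ℝ h) x :=
    (H.fderiv_right (m := 1) (by norm_num)).differentiableAt (by norm_num)
  have key : ∀ c d : ι, pd c (pd d h) x
      = fderiv ℝ (fderiv ℝ h) x (Pi.single c 1) (Pi.single d 1) := by
    intro c d
    change fderiv ℝ (fun z => fderiv ℝ h z (Pi.single d 1)) x _ = _
    rw [fderiv_clm_apply hd (differentiableAt_const _)]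
    simp
  rw [key, key]
  exact (H.isSymmSndFDerivAt (by simp)).eq _ _

end PartialDerivatives

/-! ### Functions of `r` and of the coordinates of `K` -/

section Separated

variable {n : ℕ} {V : Type*} [NormedAddCommGroup V] [NormedSpace ℝ V]

/-- The coordinates of a point that belong to `K`. -/
def ang (x : Idx n → ℝ) : Fin n → ℝ := fun i => x (Sum.inr i)

theorem hasFDerivAt_ang (x : Idx n → ℝ) :
    HasFDerivAt (ang (n := n))
      (ContinuousLinearMap.pi fun i => ContinuousLinearMap.proj (R := ℝ) (φ := fun _ : Idx n => ℝ)
        (Sum.inr i)) x :=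
  ContinuousLinearMap.hasFDerivAt (ContinuousLinearMap.pi fun i =>
    ContinuousLinearMap.proj (R := ℝ) (φ := fun _ : Idx n => ℝ) (Sum.inr i))

theorem pd_radial {u : ℝ → V} {x : Idx n → ℝ} (hu : DifferentiableAt ℝ u (x (Sum.inl 1)))
    (a : Idx n) :
    pd a (fun z => u (z (Sum.inl 1))) x
      = if a = Sum.inl 1 then deriv u (x (Sum.inl 1)) else 0 := by
  have h1 : HasFDerivAt (fun z : Idx n → ℝ => z (Sum.inl 1))
      (ContinuousLinearMap.proj (R := ℝ) (φ := fun _ : Idx n => ℝ) (Sum.inl 1)) x :=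
    (ContinuousLinearMap.proj (R := ℝ) (φ := fun _ : Idx n => ℝ) (Sum.inl 1)).hasFDerivAt
  rw [pd, show (fun z : Idx n → ℝ => u (z (Sum.inl 1))) = u ∘ fun z => z (Sum.inl 1) from rfl,
    (hu.hasDerivAt.hasFDerivAt.comp x h1).fderiv]
  by_cases h : a = Sum.inl 1
  · subst h; simp
  · simp [h, Ne.symm h]

theorem differentiableAt_radial {u : ℝ → V} {x : Idx n → ℝ}
    (hu : DifferentiableAt ℝ u (x (Sum.inl 1))) :
    DifferentiableAt ℝ (fun z : Idx n → ℝ => u (z (Sum.inl 1))) x := by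
  fun_prop

theorem differentiableAt_angular {v : (Fin n → ℝ) → V} {x : Idx n → ℝ}
    (hv : DifferentiableAt ℝ v (ang x)) : DifferentiableAt ℝ (fun z => v (ang z)) x :=
  hv.comp x (hasFDerivAt_ang x).differentiableAt

theorem pd_inl_angular {v : (Fin n → ℝ) → V} {x : Idx n → ℝ}
    (hv : DifferentiableAt ℝ v (ang x)) (c : Fin 2) :
    pd (Sum.inl c) (fun z => v (ang z)) x = 0 := by
  rw [pd, show (fun z => v (ang z)) = v ∘ ang from rfl,
    (hv.hasFDerivAt.comp x (hasFDerivAt_ang x)).fderiv]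
  have : (ContinuousLinearMap.pi fun i => ContinuousLinearMap.proj (R := ℝ)
      (φ := fun _ : Idx n => ℝ) (Sum.inr i)) (Pi.single (Sum.inl c) (1 : ℝ)) = 0 := by
    ext i; simp
  simp [this]

theorem pd_inr_angular {v : (Fin n → ℝ) → V} {x : Idx n → ℝ}
    (hv : DifferentiableAt ℝ v (ang x)) (k : Fin n) :
    pd (Sum.inr k) (fun z => v (ang z)) x = pd k v (ang x) := by
  rw [pd, pd, show (fun z => v (ang z)) = v ∘ ang from rfl,
    (hv.hasFDerivAt.comp x (hasFDerivAt_ang x)).fderiv]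
  have : (ContinuousLinearMap.pi fun i => ContinuousLinearMap.proj (R := ℝ)
      (φ := fun _ : Idx n => ℝ) (Sum.inr i)) (Pi.single (Sum.inr k) (1 : ℝ))
        = Pi.single k 1 := by
    ext i; simp [Pi.single_apply]
  rw [ContinuousLinearMap.comp_apply, this]

theorem pd_inl_zero_separated {u : ℝ → ℝ} {v : (Fin n → ℝ) → ℝ} {x : Idx n → ℝ}
    (hu : DifferentiableAt ℝ u (x (Sum.inl 1))) (hv : DifferentiableAt ℝ v (ang x)) :
    pd (Sum.inl 0) (fun z => u (z (Sum.inl 1)) * v (ang z)) x = 0 := by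
  have := pd_smul (differentiableAt_radial hu) (differentiableAt_angular hv) (Sum.inl 0)
  simpa [pd_inl_angular hv, pd_radial hu] using this

theorem pd_inl_one_separated {u : ℝ → ℝ} {v : (Fin n → ℝ) → ℝ} {x : Idx n → ℝ}
    (hu : DifferentiableAt ℝ u (x (Sum.inl 1))) (hv : DifferentiableAt ℝ v (ang x)) :
    pd (Sum.inl 1) (fun z => u (z (Sum.inl 1)) * v (ang z)) x
      = deriv u (x (Sum.inl 1)) * v (ang x) := by
  have := pd_smul (differentiableAt_radial hu) (differentiableAt_angular hv) (Sum.inl 1)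
  simpa [pd_inl_angular hv, pd_radial hu] using this

theorem pd_inr_separated {u : ℝ → ℝ} {v : (Fin n → ℝ) → ℝ} {x : Idx n → ℝ}
    (hu : DifferentiableAt ℝ u (x (Sum.inl 1))) (hv : DifferentiableAt ℝ v (ang x)) (k : Fin n) :
    pd (Sum.inr k) (fun z => u (z (Sum.inl 1)) * v (ang z)) x
      = u (x (Sum.inl 1)) * pd k v (ang x) := by
  have := pd_smul (differentiableAt_radial hu) (differentiableAt_angular hv) (Sum.inr k)
  simpa [pd_inr_angular hv, pd_radial hu] using this

end Separated

/-! ### Differentiability of the inverse metric and of the Christoffel symbols -/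

section Differentiability

variable {ι : Type*} [Fintype ι] [DecidableEq ι]

theorem contDiffAt_det {m : WithTop ℕ∞} {E : Type*} [NormedAddCommGroup E] [NormedSpace ℝ E]
    {A : E → Matrix ι ι ℝ} {y : E} (hA : ∀ i j, ContDiffAt ℝ m (fun z => A z i j) y) :
    ContDiffAt ℝ m (fun z => (A z).det) y := by
  simp only [Matrix.det_apply]
  refine ContDiffAt.sum fun σ _ => ?_
  simp only [Units.smul_def, zsmul_eq_mul]
  exact contDiffAt_const.mul (contDiffAt_prod fun i _ => hA _ _)

theorem contDiffAt_invMetric {m : WithTop ℕ∞} {g : (ι → ℝ) → Matrix ι ι ℝ} {y : ι → ℝ}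
    (hg : ∀ i j, ContDiffAt ℝ m (fun z => g z i j) y) (hd : (g y).det ≠ 0) (i j : ι) :
    ContDiffAt ℝ m (fun z => invMetric g z i j) y := by
  -- Cramer's rule: the entries of the inverse are quotients of determinants, that is of polynomials
  -- in the entries of `g`, so smoothness is inherited wherever `det g ≠ 0`.
  have h : (fun z => invMetric g z i j)
      = fun z => ((g z).det)⁻¹ * ((g z).updateRow j (Pi.single i 1)).det := by
    funext z
    simp [invMetric, Matrix.inv_def, Matrix.adjugate_apply]
  rw [h]
  refine ((contDiffAt_det hg).inv hd).mul (contDiffAt_det fun a b => ?_)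
  by_cases hab : a = j
  · subst hab
    simpa using contDiffAt_const
  · simpa [Matrix.updateRow_ne hab] using hg a b

theorem differentiableAt_christoffel {g : (ι → ℝ) → Matrix ι ι ℝ} {y : ι → ℝ}
    (hg : ∀ i j, ContDiffAt ℝ 2 (fun z => g z i j) y) (hd : (g y).det ≠ 0) (c a b : ι) :
    DifferentiableAt ℝ (fun z => christoffel g z c a b) y := by
  have h1 : ∀ i j, DifferentiableAt ℝ (fun z => invMetric g z i j) y := fun i j =>
    (contDiffAt_invMetric hg hd i j).differentiableAt (by norm_num)
  have h2 : ∀ a i j, DifferentiableAt ℝ (fun z => pd a (fun w => g w i j) z) y := fun a i j =>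
    differentiableAt_pd (hg i j) a
  unfold christoffel
  refine (differentiableAt_const _).mul (DifferentiableAt.fun_sum fun e _ => ?_)
  exact (h1 c e).mul (((h2 _ _ _).add (h2 _ _ _)).sub (h2 _ _ _))

theorem christoffel_symm {g : (ι → ℝ) → Matrix ι ι ℝ} (hg : ∀ z i j, g z i j = g z j i)
    (y : ι → ℝ) (c a b : ι) : christoffel g y c a b = christoffel g y c b a := by
  unfold christoffel
  congr 1
  refine Finset.sum_congr rfl fun e _ => ?_
  rw [show (fun z => g z a b) = fun z => g z b a from funext fun z => hg z a b]
  ring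

end Differentiability

/-! ### The warped product metric and its Christoffel symbols -/

section Warped

variable {n : ℕ}

/-- The metric `-f(r) dt² + dr² / f(r) + r² h` in the coordinates `(t, r, y)`. -/
def warpedMetric (f : ℝ → ℝ) (h : (Fin n → ℝ) → Matrix (Fin n) (Fin n) ℝ) (x : Idx n → ℝ) :
    Matrix (Idx n) (Idx n) ℝ :=
  Matrix.fromBlocks (Matrix.diagonal ![-f (x (Sum.inl 1)), (f (x (Sum.inl 1)))⁻¹]) 0 0
    (x (Sum.inl 1) ^ 2 • h (ang x))

/-- The inverse of `warpedMetric`. -/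
def warpedInv (f : ℝ → ℝ) (h : (Fin n → ℝ) → Matrix (Fin n) (Fin n) ℝ) (x : Idx n → ℝ) :
    Matrix (Idx n) (Idx n) ℝ :=
  Matrix.fromBlocks (Matrix.diagonal ![-(f (x (Sum.inl 1)))⁻¹, f (x (Sum.inl 1))]) 0 0
    ((x (Sum.inl 1) ^ 2)⁻¹ • invMetric h (ang x))

/-- The Christoffel symbols of `warpedMetric`. -/
def warpedChristoffel (f : ℝ → ℝ) (h : (Fin n → ℝ) → Matrix (Fin n) (Fin n) ℝ) (x : Idx n → ℝ) :
    Idx n → Idx n → Idx n → ℝ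
  | Sum.inl c, Sum.inl a, Sum.inl b =>
    if c = 0 then (if a = b then 0 else deriv f (x (Sum.inl 1)) / (2 * f (x (Sum.inl 1))))
    else if a = b then (if a = 0 then f (x (Sum.inl 1)) * deriv f (x (Sum.inl 1)) / 2
      else -(deriv f (x (Sum.inl 1)) / (2 * f (x (Sum.inl 1))))) else 0
  | Sum.inl c, Sum.inr i, Sum.inr j =>
    if c = 0 then 0 else -(x (Sum.inl 1) * f (x (Sum.inl 1))) * h (ang x) i j
  | Sum.inr k, Sum.inl a, Sum.inr j => if a = 0 then 0 else if k = j then (x (Sum.inl 1))⁻¹ else 0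
  | Sum.inr k, Sum.inr j, Sum.inl a => if a = 0 then 0 else if k = j then (x (Sum.inl 1))⁻¹ else 0
  | Sum.inr k, Sum.inr i, Sum.inr j => christoffel h (ang x) k i j
  | Sum.inl _, Sum.inl _, Sum.inr _ => 0
  | Sum.inl _, Sum.inr _, Sum.inl _ => 0
  | Sum.inr _, Sum.inl _, Sum.inl _ => 0

section

variable (f : ℝ → ℝ) (h : (Fin n → ℝ) → Matrix (Fin n) (Fin n) ℝ) (x : Idx n → ℝ)

theorem pd_metric_inl_ne {c d : Fin 2} (hcd : c ≠ d) (a : Idx n) :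
    pd a (fun z => warpedMetric f h z (Sum.inl c) (Sum.inl d)) x = 0 := by
  have : (fun z : Idx n → ℝ => warpedMetric f h z (Sum.inl c) (Sum.inl d))
      = fun z => 0 := by funext z; simp [warpedMetric, hcd]
  rw [this, pd_const]

theorem pd_metric_inl_inr (c : Fin 2) (j : Fin n) (a : Idx n) :
    pd a (fun z => warpedMetric f h z (Sum.inl c) (Sum.inr j)) x = 0 := by
  have : (fun z : Idx n → ℝ => warpedMetric f h z (Sum.inl c) (Sum.inr j))
      = fun z => 0 := by funext z; simp [warpedMetric]
  rw [this, pd_const]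

theorem pd_metric_inr_inl (c : Fin 2) (j : Fin n) (a : Idx n) :
    pd a (fun z => warpedMetric f h z (Sum.inr j) (Sum.inl c)) x = 0 := by
  have : (fun z : Idx n → ℝ => warpedMetric f h z (Sum.inr j) (Sum.inl c))
      = fun z => 0 := by funext z; simp [warpedMetric]
  rw [this, pd_const]

theorem warpedMetric_inr_inr (i j : Fin n) :
    (fun z : Idx n → ℝ => warpedMetric f h z (Sum.inr i) (Sum.inr j))
      = fun z => (fun r => r ^ 2) (z (Sum.inl 1)) * (fun y => h y i j) (ang z) := by
  funext z; simp [warpedMetric]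

end

/-- An open set of coordinates on which `warpedMetric f h` is a `C²` static metric. -/
structure IsWarpedPatch (f : ℝ → ℝ) (h : (Fin n → ℝ) → Matrix (Fin n) (Fin n) ℝ)
    (S : Set (Idx n → ℝ)) : Prop where
  isOpen : IsOpen S
  r_pos : ∀ x ∈ S, 0 < x (Sum.inl 1)
  f_pos : ∀ x ∈ S, 0 < f (x (Sum.inl 1))
  contDiffAt_f : ∀ x ∈ S, ContDiffAt ℝ 2 f (x (Sum.inl 1))
  contDiffAt_h : ∀ x ∈ S, ∀ i j, ContDiffAt ℝ 2 (fun y => h y i j) (ang x)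
  symm : ∀ y i j, h y i j = h y j i
  det_ne_zero : ∀ x ∈ S, (h (ang x)).det ≠ 0

namespace IsWarpedPatch

variable {f : ℝ → ℝ} {h : (Fin n → ℝ) → Matrix (Fin n) (Fin n) ℝ} {S : Set (Idx n → ℝ)}
  (H : IsWarpedPatch f h S) {x : Idx n → ℝ} (hx : x ∈ S)

include H hx

theorem differentiableAt_f : DifferentiableAt ℝ f (x (Sum.inl 1)) :=
  (H.contDiffAt_f x hx).differentiableAt (by norm_num)

theorem differentiableAt_deriv_f : DifferentiableAt ℝ (deriv f) (x (Sum.inl 1)) := by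
  have : ContDiffAt ℝ 1 (fun r => fderiv ℝ f r 1) (x (Sum.inl 1)) :=
    ((H.contDiffAt_f x hx).fderiv_right (by norm_num)).clm_apply contDiffAt_const
  exact this.differentiableAt (by norm_num)

theorem differentiableAt_h (i j : Fin n) : DifferentiableAt ℝ (fun y => h y i j) (ang x) :=
  (H.contDiffAt_h _ hx i j).differentiableAt (by norm_num)

theorem r_ne : x (Sum.inl 1) ≠ 0 := (H.r_pos x hx).ne'

theorem f_ne : f (x (Sum.inl 1)) ≠ 0 := (H.f_pos x hx).ne'

theorem inv_mul_h (k j : Fin n) : ∑ e, invMetric h (ang x) k e * h (ang x) e j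
    = if k = j then 1 else 0 := by
  have := congrFun (congrFun (Matrix.nonsing_inv_mul (h (ang x))
    (isUnit_iff_ne_zero.2 (H.det_ne_zero x hx))) k) j
  rwa [Matrix.mul_apply, Matrix.one_apply] at this

theorem inv_symm (i j : Fin n) : invMetric h (ang x) i j = invMetric h (ang x) j i := by
  have h1 : (h (ang x)).transpose = h (ang x) := by ext i j; exact H.symm _ _ _
  have : ((h (ang x))⁻¹).transpose = (h (ang x))⁻¹ := by rw [Matrix.transpose_nonsing_inv, h1]
  exact (congrFun (congrFun this j) i)

theorem trace_inv_mul : ∑ i, ∑ j, invMetric h (ang x) i j * h (ang x) i j = n := by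
  have : ∀ i, ∑ j, invMetric h (ang x) i j * h (ang x) i j = 1 := fun i => by
    refine (Finset.sum_congr rfl fun j _ => ?_).trans ((H.inv_mul_h hx i i).trans (if_pos rfl))
    rw [H.symm _ i j]
  simp [this]

theorem invMetric_eq : invMetric (warpedMetric f h) x = warpedInv f h x := by
  refine Matrix.inv_eq_right_inv ?_
  have hf := H.f_ne hx
  have hr := H.r_ne hx
  rw [warpedMetric, warpedInv, Matrix.fromBlocks_multiply, ← Matrix.fromBlocks_one]
  congr 1
  · rw [Matrix.diagonal_mul_diagonal]
    ext a b
    fin_cases a <;> fin_cases b <;> simp [hf]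
  · simp
  · simp
  · rw [Matrix.mul_zero, zero_add, Matrix.smul_mul, Matrix.mul_smul, smul_smul,
      mul_inv_cancel₀ (pow_ne_zero _ hr), one_smul]
    exact Matrix.mul_nonsing_inv _ (isUnit_iff_ne_zero.2 (H.det_ne_zero x hx))

theorem pd_metric_tt (a : Idx n) : pd a (fun z => warpedMetric f h z (Sum.inl 0) (Sum.inl 0)) x
    = if a = Sum.inl 1 then -deriv f (x (Sum.inl 1)) else 0 := by
  have : (fun z : Idx n → ℝ => warpedMetric f h z (Sum.inl 0) (Sum.inl 0))
      = fun z => -f (z (Sum.inl 1)) := by funext z; simp [warpedMetric]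
  rw [this, pd_neg, pd_radial (H.differentiableAt_f hx)]
  split_ifs <;> simp

theorem pd_metric_rr (a : Idx n) : pd a (fun z => warpedMetric f h z (Sum.inl 1) (Sum.inl 1)) x
    = if a = Sum.inl 1 then -deriv f (x (Sum.inl 1)) / f (x (Sum.inl 1)) ^ 2 else 0 := by
  have : (fun z : Idx n → ℝ => warpedMetric f h z (Sum.inl 1) (Sum.inl 1))
      = fun z => (fun r => (f r)⁻¹) (z (Sum.inl 1)) := by funext z; simp [warpedMetric]
  rw [this, pd_radial ((H.differentiableAt_f hx).fun_inv (H.f_ne hx)),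
    deriv_fun_inv'' (H.differentiableAt_f hx) (H.f_ne hx)]

theorem pd_metric_t_inr (i j : Fin n) :
    pd (Sum.inl 0) (fun z => warpedMetric f h z (Sum.inr i) (Sum.inr j)) x = 0 := by
  rw [warpedMetric_inr_inr]
  exact pd_inl_zero_separated (u := fun r => r ^ 2) (by fun_prop)
    (H.differentiableAt_h hx i j)

theorem pd_metric_r_inr (i j : Fin n) :
    pd (Sum.inl 1) (fun z => warpedMetric f h z (Sum.inr i) (Sum.inr j)) x
      = 2 * x (Sum.inl 1) * h (ang x) i j := by
  rw [warpedMetric_inr_inr]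
  refine (pd_inl_one_separated (u := fun r => r ^ 2) (by fun_prop)
    (H.differentiableAt_h hx i j)).trans ?_
  simp

theorem pd_metric_inr_inr (i j k : Fin n) :
    pd (Sum.inr k) (fun z => warpedMetric f h z (Sum.inr i) (Sum.inr j)) x
      = x (Sum.inl 1) ^ 2 * pd k (fun y => h y i j) (ang x) := by
  rw [warpedMetric_inr_inr]
  exact pd_inr_separated (u := fun r => r ^ 2) (by fun_prop)
    (H.differentiableAt_h hx i j) k

theorem christoffel_eq (c a b : Idx n) :
    christoffel (warpedMetric f h) x c a b = warpedChristoffel f h x c a b := by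
  have hf := H.f_ne hx
  have hr := H.r_ne hx
  have h01 : (0 : Fin 2) ≠ 1 := by decide
  have h10 : (1 : Fin 2) ≠ 0 := by decide
  have hinv := H.inv_mul_h hx
  -- The mixed symbols `Γ^c_{rb}` contract `∂_r (r² h) = 2 r h` with the inverse of `r² h`, which
  -- leaves `δ^c_b / r`.
  have hmix : ∀ c b, 2⁻¹ * ∑ e, (x (Sum.inl 1) ^ 2)⁻¹ * invMetric h (ang x) c e *
      (2 * x (Sum.inl 1) * h (ang x) e b) = if c = b then (x (Sum.inl 1))⁻¹ else 0 := by
    intro c b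
    have : ∀ e, (x (Sum.inl 1) ^ 2)⁻¹ * invMetric h (ang x) c e *
        (2 * x (Sum.inl 1) * h (ang x) e b)
          = (2 * (x (Sum.inl 1))⁻¹) * (invMetric h (ang x) c e * h (ang x) e b) := fun e => by
      field_simp
    rw [Finset.sum_congr rfl fun e _ => this e, ← Finset.mul_sum, hinv]
    split_ifs <;> simp
  simp only [christoffel, H.invMetric_eq hx, Fintype.sum_sum_type, Fin.sum_univ_two]
  rcases c with c | c <;> rcases a with a | a <;> rcases b with b | b <;>
  (try fin_cases c) <;> (try fin_cases a) <;> (try fin_cases b) <;>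
  simp [warpedInv, warpedChristoffel, H.pd_metric_tt hx, H.pd_metric_rr hx,
    pd_metric_inl_ne f h x h01, pd_metric_inl_ne f h x h10, pd_metric_inl_inr,
    pd_metric_inr_inl, H.pd_metric_t_inr hx, H.pd_metric_r_inr hx, H.pd_metric_inr_inr hx]
  case inr.inr.inr =>
    rw [christoffel, Finset.mul_sum, Finset.mul_sum]
    refine Finset.sum_congr rfl fun e _ => ?_
    field_simp
  all_goals first | exact hmix _ _ | field_simp

end IsWarpedPatch

end Warped

/-! ### Curvature of the warped product metric -/

section WarpedCurvature

variable {n : ℕ}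

namespace IsWarpedPatch

variable {f : ℝ → ℝ} {h : (Fin n → ℝ) → Matrix (Fin n) (Fin n) ℝ} {S : Set (Idx n → ℝ)}
  (H : IsWarpedPatch f h S) {x : Idx n → ℝ} (hx : x ∈ S)

include H hx

theorem differentiableAt_christoffel_h (k i j : Fin n) :
    DifferentiableAt ℝ (fun y => christoffel h y k i j) (ang x) :=
  differentiableAt_christoffel (H.contDiffAt_h x hx) (H.det_ne_zero x hx) k i j

/-- The closed form holds only on the patch; since the patch is open, it may be differentiated
there. -/
theorem pd_christoffel_eq (a c b d : Idx n) :
    pd a (fun z => christoffel (warpedMetric f h) z c b d) x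
      = pd a (fun z => warpedChristoffel f h z c b d) x :=
  pd_congr_on H.isOpen (fun _ hz => H.christoffel_eq hz c b d) hx a

theorem pd_christoffel_inl_inl_inr (a : Idx n) (c b : Fin 2) (j : Fin n) :
    pd a (fun z => christoffel (warpedMetric f h) z (Sum.inl c) (Sum.inl b) (Sum.inr j)) x = 0 := by
  rw [H.pd_christoffel_eq hx]
  exact pd_const _ _ _

theorem pd_christoffel_inr_inl_inl (a : Idx n) (k : Fin n) (b c : Fin 2) :
    pd a (fun z => christoffel (warpedMetric f h) z (Sum.inr k) (Sum.inl b) (Sum.inl c)) x = 0 := by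
  rw [H.pd_christoffel_eq hx]
  exact pd_const _ _ _

theorem pd_christoffel_t_tr {b c : Fin 2} (hbc : b ≠ c) (a : Idx n) :
    pd a (fun z => christoffel (warpedMetric f h) z (Sum.inl 0) (Sum.inl b) (Sum.inl c)) x
      = if a = Sum.inl 1 then deriv (deriv f) (x (Sum.inl 1)) / (2 * f (x (Sum.inl 1)))
        - deriv f (x (Sum.inl 1)) ^ 2 / (2 * f (x (Sum.inl 1)) ^ 2) else 0 := by
  have hf := H.f_ne hx
  rw [H.pd_christoffel_eq hx]
  have hd := (H.differentiableAt_deriv_f hx).hasDerivAt.fun_div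
    ((H.differentiableAt_f hx).hasDerivAt.const_mul 2) (by simpa using hf)
  simp only [warpedChristoffel, hbc, if_true, if_false]
  rw [pd_radial hd.differentiableAt, hd.deriv]
  split_ifs
  · field_simp
  · rfl

theorem pd_christoffel_t_self (b : Fin 2) (a : Idx n) :
    pd a (fun z => christoffel (warpedMetric f h) z (Sum.inl 0) (Sum.inl b) (Sum.inl b)) x = 0 := by
  rw [H.pd_christoffel_eq hx]
  simp [warpedChristoffel]

theorem pd_christoffel_r_tr {b c : Fin 2} (hbc : b ≠ c) (a : Idx n) :
    pd a (fun z => christoffel (warpedMetric f h) z (Sum.inl 1) (Sum.inl b) (Sum.inl c)) x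
      = 0 := by
  rw [H.pd_christoffel_eq hx]
  simp [warpedChristoffel, hbc]

theorem pd_christoffel_r_tt (a : Idx n) :
    pd a (fun z => christoffel (warpedMetric f h) z (Sum.inl 1) (Sum.inl 0) (Sum.inl 0)) x
      = if a = Sum.inl 1 then (deriv f (x (Sum.inl 1)) ^ 2
        + f (x (Sum.inl 1)) * deriv (deriv f) (x (Sum.inl 1))) / 2 else 0 := by
  rw [H.pd_christoffel_eq hx]
  have hd := ((H.differentiableAt_f hx).hasDerivAt.fun_mul
    (H.differentiableAt_deriv_f hx).hasDerivAt).div_const 2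
  simp only [warpedChristoffel, one_ne_zero, if_true, if_false]
  rw [pd_radial hd.differentiableAt, hd.deriv]
  simp only [sq]

theorem pd_inl_zero_christoffel_rr :
    pd (Sum.inl 0) (fun z => christoffel (warpedMetric f h) z (Sum.inl 1) (Sum.inl 1) (Sum.inl 1)) x
      = 0 := by
  have hf := H.f_ne hx
  rw [H.pd_christoffel_eq hx]
  have hd := ((H.differentiableAt_deriv_f hx).hasDerivAt.fun_div
    ((H.differentiableAt_f hx).hasDerivAt.const_mul 2) (by simpa using hf)).fun_neg
  simp only [warpedChristoffel, one_ne_zero, if_true, if_false]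
  rw [pd_radial hd.differentiableAt]
  simp

theorem pd_christoffel_t_inr_inr (a : Idx n) (i j : Fin n) :
    pd a (fun z => christoffel (warpedMetric f h) z (Sum.inl 0) (Sum.inr i) (Sum.inr j)) x = 0 := by
  rw [H.pd_christoffel_eq hx]
  simp [warpedChristoffel]

theorem pd_christoffel_r_inr_inr (i j : Fin n) :
    pd (Sum.inl 1)
      (fun z => christoffel (warpedMetric f h) z (Sum.inl 1) (Sum.inr i) (Sum.inr j)) x
      = -(f (x (Sum.inl 1)) + x (Sum.inl 1) * deriv f (x (Sum.inl 1))) * h (ang x) i j := by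
  rw [H.pd_christoffel_eq hx]
  have hd := ((hasDerivAt_id (x (Sum.inl 1))).fun_mul (H.differentiableAt_f hx).hasDerivAt).fun_neg
  refine (pd_inl_one_separated hd.differentiableAt (H.differentiableAt_h hx i j)).trans ?_
  rw [hd.deriv]
  simp

theorem pd_christoffel_inr_mixed (a : Idx n) (b : Fin 2) (k j : Fin n) :
    pd a (fun z => christoffel (warpedMetric f h) z (Sum.inr k) (Sum.inr j) (Sum.inl b)) x
      = if b = 0 then 0 else if k = j then (if a = Sum.inl 1 then -(x (Sum.inl 1) ^ 2)⁻¹ else 0)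
        else 0 := by
  rw [H.pd_christoffel_eq hx]
  simp only [warpedChristoffel]
  split_ifs
  · simp
  · rw [pd_radial (u := fun r => r⁻¹) (differentiableAt_inv (H.r_ne hx))]
    simp [*]
  · rw [pd_radial (u := fun r => r⁻¹) (differentiableAt_inv (H.r_ne hx))]
    simp [*]
  · simp

theorem pd_christoffel_inr_inr_inr (k i j l : Fin n) :
    pd (Sum.inr k)
      (fun z => christoffel (warpedMetric f h) z (Sum.inr l) (Sum.inr i) (Sum.inr j)) x
      = pd k (fun y => christoffel h y l i j) (ang x) := by
  rw [H.pd_christoffel_eq hx]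
  exact pd_inr_angular (H.differentiableAt_christoffel_h hx l i j) k

/-- The leaves of constant `K` coordinates are totally geodesic (`Γ^k_{ab} = 0` for `a, b` in `{t,
r}`), so this block is the curvature of the surface `-f dt² + dr²/f`. -/
theorem riemannUp_inl (a b c d : Fin 2) :
    riemannUp (warpedMetric f h) x (Sum.inl a) (Sum.inl b) (Sum.inl c) (Sum.inl d)
      = if a = b ∨ c = d then 0 else
        (if c = 0 then 1 else -1) * (if a = 0 then -(deriv (deriv f) (x (Sum.inl 1))
          / (2 * f (x (Sum.inl 1))))
          else -(f (x (Sum.inl 1)) * deriv (deriv f) (x (Sum.inl 1)) / 2)) := by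
  have hf := H.f_ne hx
  have h01 : (0 : Fin 2) ≠ 1 := by decide
  have h10 : (1 : Fin 2) ≠ 0 := by decide
  simp only [riemannUp, Fintype.sum_sum_type, Fin.sum_univ_two, H.christoffel_eq hx]
  fin_cases a <;> fin_cases b <;> fin_cases c <;> fin_cases d <;>
  simp [warpedChristoffel, H.pd_christoffel_t_tr hx h01, H.pd_christoffel_t_tr hx h10,
    H.pd_christoffel_t_self hx, H.pd_christoffel_r_tr hx h01, H.pd_christoffel_r_tr hx h10,
    H.pd_christoffel_r_tt hx, H.pd_inl_zero_christoffel_rr hx] <;>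
  field_simp <;> ring

/-- The surface contributes the term in `f''`; each of the `n` directions of `K` contributes
`f'/(2r)` through the Hessian of the warping function `r`. -/
theorem ricci_inl_inl (a b : Fin 2) :
    ricci (warpedMetric f h) x (Sum.inl a) (Sum.inl b)
      = -(deriv (deriv f) (x (Sum.inl 1)) / 2
        + n * deriv f (x (Sum.inl 1)) / (2 * x (Sum.inl 1)))
        * warpedMetric f h x (Sum.inl a) (Sum.inl b) := by
  have hf := H.f_ne hx
  have hr := H.r_ne hx
  simp only [ricci, Fintype.sum_sum_type (f := fun c => riemannUp _ _ c _ c _), Fin.sum_univ_two,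
    H.riemannUp_inl hx]
  simp only [riemannUp, Fintype.sum_sum_type, Fin.sum_univ_two, H.christoffel_eq hx]
  fin_cases a <;> fin_cases b <;>
  simp [warpedChristoffel, warpedMetric, H.pd_christoffel_inr_inl_inl hx,
    H.pd_christoffel_inr_mixed hx] <;>
  field_simp <;> ring

theorem ricci_inr_inr (i j : Fin n) :
    ricci (warpedMetric f h) x (Sum.inr i) (Sum.inr j)
      = ricci h (ang x) i j - (((n : ℝ) - 1) * f (x (Sum.inl 1))
        + x (Sum.inl 1) * deriv f (x (Sum.inl 1))) * h (ang x) i j := by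
  have hf := H.f_ne hx
  have hr := H.r_ne hx
  have hs := H.symm (ang x)
  -- Gauss equation for the spheres of constant `t, r`: the curvature of `h` is corrected by the
  -- square of their second fundamental form, which is `f` times the constant curvature tensor.
  -- Summing over `k` will give `-(n-1) f h`.
  have hk : ∀ k, riemannUp (warpedMetric f h) x (Sum.inr k) (Sum.inr i) (Sum.inr k) (Sum.inr j)
      = riemannUp h (ang x) k i k j - f (x (Sum.inl 1)) * h (ang x) i j
        + if k = j then f (x (Sum.inl 1)) * h (ang x) i j else 0 := by
    intro k
    simp only [riemannUp, Fintype.sum_sum_type, Fin.sum_univ_two, H.christoffel_eq hx,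
      H.pd_christoffel_inr_inr_inr hx]
    by_cases hkj : k = j
    · subst hkj
      simp [warpedChristoffel, hs k i]
    · simp [warpedChristoffel, hkj, hs j i]
      field_simp
      ring
  have ht : riemannUp (warpedMetric f h) x (Sum.inl 0) (Sum.inr i) (Sum.inl 0) (Sum.inr j)
      = -(x (Sum.inl 1) * deriv f (x (Sum.inl 1)) / 2) * h (ang x) i j := by
    simp [riemannUp, Fintype.sum_sum_type, Fin.sum_univ_two, H.christoffel_eq hx,
      warpedChristoffel, H.pd_christoffel_t_inr_inr hx, H.pd_christoffel_inl_inl_inr hx, hs j i]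
    field_simp
  have hr' : riemannUp (warpedMetric f h) x (Sum.inl 1) (Sum.inr i) (Sum.inl 1) (Sum.inr j)
      = -(x (Sum.inl 1) * deriv f (x (Sum.inl 1)) / 2) * h (ang x) i j := by
    simp [riemannUp, Fintype.sum_sum_type, Fin.sum_univ_two, H.christoffel_eq hx,
      warpedChristoffel, H.pd_christoffel_r_inr_inr hx, H.pd_christoffel_inl_inl_inr hx, hs j i]
    field_simp
    ring
  rw [ricci, Fintype.sum_sum_type, Fin.sum_univ_two, ht, hr', Finset.sum_congr rfl fun k _ => hk k,
    Finset.sum_add_distrib, Finset.sum_sub_distrib, ← ricci]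
  simp
  ring

theorem scalarCurv_eq {c : ℝ} (hE : ∀ i j, ricci h (ang x) i j = c * h (ang x) i j) :
    scalarCurv (warpedMetric f h) x
      = -deriv (deriv f) (x (Sum.inl 1)) - 2 * n * deriv f (x (Sum.inl 1)) / x (Sum.inl 1)
        + n * (c - ((n : ℝ) - 1) * f (x (Sum.inl 1))) / x (Sum.inl 1) ^ 2 := by
  have hf := H.f_ne hx
  have hr := H.r_ne hx
  have key : ∑ i, ∑ j, warpedInv f h x (Sum.inr i) (Sum.inr j)
      * ricci (warpedMetric f h) x (Sum.inr i) (Sum.inr j)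
      = (x (Sum.inl 1) ^ 2)⁻¹ * (c - (((n : ℝ) - 1) * f (x (Sum.inl 1))
        + x (Sum.inl 1) * deriv f (x (Sum.inl 1)))) * n := by
    refine Eq.trans ?_ (congrArg (_ * ·) (H.trace_inv_mul hx))
    simp only [Finset.mul_sum, H.ricci_inr_inr hx, hE]
    refine Finset.sum_congr rfl fun i _ => Finset.sum_congr rfl fun j _ => ?_
    simp [warpedInv]
    ring
  simp only [scalarCurv, H.invMetric_eq hx, Fintype.sum_sum_type, Finset.sum_add_distrib, key,
    Fin.sum_univ_two, H.ricci_inl_inl hx]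
  simp [warpedInv, warpedMetric]
  field_simp
  ring

/-- On a two-dimensional block every algebraic curvature tensor is a multiple of a single one. The
multiple collects the Riemann, Ricci and scalar parts, whose signs come from `g_tt g_rr = -1`. -/
theorem weyl_inl {c : ℝ} (hE : ∀ i j, ricci h (ang x) i j = c * h (ang x) i j) (hn : n ≠ 0)
    (a b d e : Fin 2) :
    weyl (warpedMetric f h) x (Sum.inl a) (Sum.inl b) (Sum.inl d) (Sum.inl e)
      = (deriv (deriv f) (x (Sum.inl 1)) / 2
        - 2 / n * (deriv (deriv f) (x (Sum.inl 1)) / 2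
          + n * deriv f (x (Sum.inl 1)) / (2 * x (Sum.inl 1)))
        - (-deriv (deriv f) (x (Sum.inl 1)) - 2 * n * deriv f (x (Sum.inl 1)) / x (Sum.inl 1)
          + n * (c - ((n : ℝ) - 1) * f (x (Sum.inl 1))) / x (Sum.inl 1) ^ 2) / (n * (n + 1)))
        * (if a = b ∨ d = e then 0 else if a = d then 1 else -1) := by
  have hf := H.f_ne hx
  have hr := H.r_ne hx
  have hn' : (n : ℝ) ≠ 0 := by exact_mod_cast hn
  have hn1 : (n : ℝ) + 1 ≠ 0 := by positivity
  have hc2 : ((Fintype.card (Idx n) : ℕ) : ℝ) - 2 = n := by simp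
  have hc1 : ((Fintype.card (Idx n) : ℕ) : ℝ) - 1 = n + 1 := by simp; ring
  rw [weyl, H.scalarCurv_eq hx hE, hc1, hc2]
  simp only [riemann, Fintype.sum_sum_type, Fin.sum_univ_two, H.riemannUp_inl hx,
    H.ricci_inl_inl hx]
  fin_cases a <;> fin_cases b <;> fin_cases d <;> fin_cases e <;>
  simp [warpedMetric] <;> field_simp <;> ring

end IsWarpedPatch

end WarpedCurvature

/-! ### The null frame -/

section NullFrame

variable {n : ℕ}

@[simp] theorem nullL_inr (f : ℝ → ℝ) (x : Idx n → ℝ) (i : Fin n) : nullL f x (Sum.inr i) = 0 := rfl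

@[simp] theorem nullK_inr (f : ℝ → ℝ) (x : Idx n → ℝ) (i : Fin n) : nullK f x (Sum.inr i) = 0 := rfl

theorem nullL_inl (f : ℝ → ℝ) (x : Idx n → ℝ) (a : Fin 2) : nullL f x (Sum.inl a)
    = if a = 0 then 1 / √(2 * f (x (Sum.inl 1)))
      else f (x (Sum.inl 1)) / √(2 * f (x (Sum.inl 1))) := by
  fin_cases a <;> rfl

theorem nullK_inl (f : ℝ → ℝ) (x : Idx n → ℝ) (a : Fin 2) : nullK f x (Sum.inl a)
    = if a = 0 then -1 / √(2 * f (x (Sum.inl 1)))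
      else f (x (Sum.inl 1)) / √(2 * f (x (Sum.inl 1))) := by
  fin_cases a <;> rfl

@[simp] theorem lower_warpedMetric_inr (f : ℝ → ℝ) (h : (Fin n → ℝ) → Matrix (Fin n) (Fin n) ℝ)
    {v : (Idx n → ℝ) → Idx n → ℝ} (hv : ∀ z i, v z (Sum.inr i) = 0) (x : Idx n → ℝ) (i : Fin n) :
    lower (warpedMetric f h) v x (Sum.inr i) = 0 := by
  simp [lower, Fintype.sum_sum_type, warpedMetric, hv]

namespace IsWarpedPatch

variable {f : ℝ → ℝ} {h : (Fin n → ℝ) → Matrix (Fin n) (Fin n) ℝ} {S : Set (Idx n → ℝ)}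
  (H : IsWarpedPatch f h S) {x : Idx n → ℝ} (hx : x ∈ S)

include H hx

/-- Substituting `f = s²/2` with `s = √(2f)` turns the frame identities below into identities of
rational functions of `s`. -/
theorem f_eq_sq_sqrt : f (x (Sum.inl 1)) = √(2 * f (x (Sum.inl 1))) ^ 2 / 2 := by
  rw [Real.sq_sqrt (mul_nonneg zero_le_two (H.f_pos x hx).le)]
  ring

theorem sqrt_two_f_ne : √(2 * f (x (Sum.inl 1))) ≠ 0 :=
  (Real.sqrt_pos.2 (mul_pos two_pos (H.f_pos x hx))).ne'

theorem screen_inl_inl (a b : Fin 2) :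
    screen (warpedMetric f h) (nullL f) (nullK f) x (Sum.inl a) (Sum.inl b) = 0 := by
  have h1 := H.f_eq_sq_sqrt hx
  have h2 := H.sqrt_two_f_ne hx
  simp only [screen, H.invMetric_eq hx, warpedInv, nullL_inl, nullK_inl]
  generalize √(2 * f (x (Sum.inl 1))) = s at h1 h2 ⊢
  generalize f (x (Sum.inl 1)) = F at h1 ⊢
  subst h1
  fin_cases a <;> fin_cases b <;> simp <;> field_simp <;> ring

theorem screen_inl_inr (a : Fin 2) (j : Fin n) :
    screen (warpedMetric f h) (nullL f) (nullK f) x (Sum.inl a) (Sum.inr j) = 0 := by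
  rw [screen, H.invMetric_eq hx]; simp [warpedInv]

theorem screen_inr_inl (a : Fin 2) (j : Fin n) :
    screen (warpedMetric f h) (nullL f) (nullK f) x (Sum.inr j) (Sum.inl a) = 0 := by
  rw [screen, H.invMetric_eq hx]; simp [warpedInv]

theorem screen_inr_inr (i j : Fin n) :
    screen (warpedMetric f h) (nullL f) (nullK f) x (Sum.inr i) (Sum.inr j)
      = (x (Sum.inl 1) ^ 2)⁻¹ * invMetric h (ang x) i j := by
  rw [screen, H.invMetric_eq hx]; simp [warpedInv]

/-- For `v` tangent to the `(t, r)` surface only `Γ^r_{ij} = -r f h_ij` contributes, so `∇_j v_i = r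
v^r h_ij`; its trace with `r⁻² h⁻¹` is `n v^r / r`. -/
theorem expansion_eq {v : (Idx n → ℝ) → Idx n → ℝ} (hv : ∀ z i, v z (Sum.inr i) = 0) :
    expansion (warpedMetric f h) (nullL f) (nullK f) v x
      = n * v x (Sum.inl 1) / x (Sum.inl 1) := by
  have hf := H.f_ne hx
  have hr := H.r_ne hx
  have hlow : lower (warpedMetric f h) v x (Sum.inl 1) = v x (Sum.inl 1) / f (x (Sum.inl 1)) := by
    simp [lower, Fintype.sum_sum_type, warpedMetric]
    field_simp
  have hnab : ∀ i j, nabla₁ (warpedMetric f h) (lower (warpedMetric f h) v) x (Sum.inr j)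
      (Sum.inr i) = x (Sum.inl 1) * v x (Sum.inl 1) * h (ang x) i j := by
    intro i j
    simp only [nabla₁, Fintype.sum_sum_type, Fin.sum_univ_two, H.christoffel_eq hx,
      lower_warpedMetric_inr f h hv, hlow]
    simp [warpedChristoffel, H.symm _ j i]
    field_simp
  simp only [expansion, Fintype.sum_sum_type, H.screen_inl_inl hx, H.screen_inl_inr hx,
    H.screen_inr_inl hx, H.screen_inr_inr hx, hnab]
  have : ∀ i j, (x (Sum.inl 1) ^ 2)⁻¹ * invMetric h (ang x) i j
      * (x (Sum.inl 1) * v x (Sum.inl 1) * h (ang x) i j)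
      = v x (Sum.inl 1) / x (Sum.inl 1) * (invMetric h (ang x) i j * h (ang x) i j) := by
    intro i j
    field_simp
  simp only [this]
  simp [← Finset.mul_sum, H.trace_inv_mul hx]
  ring

theorem tauForm_eq (a : Idx n) : tauForm (warpedMetric f h) (nullL f) (nullK f) x a = 0 := by
  have hnab : ∀ (c : Fin 2) (j : Fin n), nabla₁ (warpedMetric f h)
      (lower (warpedMetric f h) (nullL f)) x (Sum.inl c) (Sum.inr j) = 0 := by
    intro c j
    simp only [nabla₁, Fintype.sum_sum_type, Fin.sum_univ_two, H.christoffel_eq hx,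
      lower_warpedMetric_inr f h (nullL_inr f)]
    simp [warpedChristoffel]
  simp [tauForm, Fintype.sum_sum_type, H.screen_inl_inl hx, H.screen_inr_inl hx, hnab]

/-- With `τ = 0` and the expansions `n ℓ^r / r`, `n k^r / r`, one has `γ_a = (ℓ^r k_a + k^r ℓ_a) /
r`. As `ℓ^b k_a + k^b ℓ_a` is the projector onto the `(t, r)` plane, this is `dr / r`. -/
theorem gammaForm_eq (hn : n ≠ 0) (a : Idx n) :
    gammaForm (warpedMetric f h) (nullL f) (nullK f) x a
      = if a = Sum.inl 1 then (x (Sum.inl 1))⁻¹ else 0 := by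
  have hf := H.f_ne hx
  have hr := H.r_ne hx
  have h1 := H.f_eq_sq_sqrt hx
  have h2 := H.sqrt_two_f_ne hx
  have hn' : (n : ℝ) ≠ 0 := by exact_mod_cast hn
  have hc2 : ((Fintype.card (Idx n) : ℕ) : ℝ) - 2 = n := by simp
  rw [gammaForm, H.tauForm_eq hx, H.expansion_eq hx (nullL_inr f),
    H.expansion_eq hx (nullK_inr f), hc2]
  rcases a with a | a
  · simp only [lower, Fintype.sum_sum_type, warpedMetric, nullL_inl, nullK_inl]
    generalize √(2 * f (x (Sum.inl 1))) = s at h1 h2 ⊢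
    generalize f (x (Sum.inl 1)) = F at h1 ⊢
    subst h1
    fin_cases a <;> simp <;> field_simp <;> ring
  · simp [lower_warpedMetric_inr f h (nullL_inr f), lower_warpedMetric_inr f h (nullK_inr f)]

theorem lower_wedge (a b : Fin 2) :
    lower (warpedMetric f h) (nullL f) x (Sum.inl a) * lower (warpedMetric f h) (nullK f) x (Sum.inl b)
      - lower (warpedMetric f h) (nullK f) x (Sum.inl a)
        * lower (warpedMetric f h) (nullL f) x (Sum.inl b)
      = if a = b then 0 else if a = 0 then -1 else 1 := by
  have h1 := H.f_eq_sq_sqrt hx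
  have h2 := H.sqrt_two_f_ne hx
  simp only [lower, Fintype.sum_sum_type, warpedMetric, nullL_inl, nullK_inl]
  generalize √(2 * f (x (Sum.inl 1))) = s at h1 h2 ⊢
  generalize f (x (Sum.inl 1)) = F at h1 ⊢
  subst h1
  fin_cases a <;> fin_cases b <;> simp <;> field_simp <;> ring

/-- The area form `ℓ^t k^r - ℓ^r k^t` of the frame equals `1`, so `Φ` is exactly the coefficient of
`weyl_inl`. -/
theorem weylScalar_eq {c : ℝ} (hE : ∀ i j, ricci h (ang x) i j = c * h (ang x) i j) (hn : n ≠ 0) :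
    weylScalar (warpedMetric f h) (nullL f) (nullK f) x
      = deriv (deriv f) (x (Sum.inl 1)) / 2
        - 2 / n * (deriv (deriv f) (x (Sum.inl 1)) / 2
          + n * deriv f (x (Sum.inl 1)) / (2 * x (Sum.inl 1)))
        - (-deriv (deriv f) (x (Sum.inl 1)) - 2 * n * deriv f (x (Sum.inl 1)) / x (Sum.inl 1)
          + n * (c - ((n : ℝ) - 1) * f (x (Sum.inl 1))) / x (Sum.inl 1) ^ 2) / (n * (n + 1)) := by
  have h1 := H.f_eq_sq_sqrt hx
  have h2 := H.sqrt_two_f_ne hx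
  have hw := H.weyl_inl hx hE hn
  generalize (deriv (deriv f) (x (Sum.inl 1)) / 2
        - 2 / n * (deriv (deriv f) (x (Sum.inl 1)) / 2
          + n * deriv f (x (Sum.inl 1)) / (2 * x (Sum.inl 1)))
        - (-deriv (deriv f) (x (Sum.inl 1)) - 2 * n * deriv f (x (Sum.inl 1)) / x (Sum.inl 1)
          + n * (c - ((n : ℝ) - 1) * f (x (Sum.inl 1))) / x (Sum.inl 1) ^ 2) / (n * (n + 1))) = W
    at hw ⊢
  simp only [weylScalar, Fintype.sum_sum_type, Fin.sum_univ_two, nullL_inr, nullK_inr, mul_zero,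
    zero_mul, Finset.sum_const_zero, add_zero, hw, nullL_inl, nullK_inl]
  generalize √(2 * f (x (Sum.inl 1))) = s at h1 h2 ⊢
  generalize f (x (Sum.inl 1)) = F at h1 ⊢
  subst h1
  simp
  field_simp
  ring

/-- Contraction with `Z` only sees the `(t, r)` components. -/
theorem contract_ckyForm (B : (Idx n → ℝ) → Idx n → Idx n → ℂ) :
    contract (warpedMetric f h) (ckyForm (warpedMetric f h) (nullL f) (nullK f)) B x
      = ((weylScalar (warpedMetric f h) (nullL f) (nullK f) x : ℝ) : ℂ) ^ (-1 / ((n : ℂ) + 1))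
        * (B x (Sum.inl 0) (Sum.inl 1) - B x (Sum.inl 1) (Sum.inl 0)) := by
  have hf := H.f_ne hx
  have hc1 : ((Fintype.card (Idx n) : ℕ) : ℂ) - 1 = n + 1 := by simp; ring
  simp only [contract, ckyForm, hc1, H.invMetric_eq hx]
  generalize ((weylScalar (warpedMetric f h) (nullL f) (nullK f) x : ℝ) : ℂ) ^
    (-1 / ((n : ℂ) + 1)) = P
  have hw := H.lower_wedge hx
  simp only [Fintype.sum_sum_type, Fin.sum_univ_two, hw,
    lower_warpedMetric_inr f h (nullL_inr f), lower_warpedMetric_inr f h (nullK_inr f)]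
  have hfc : (f (x (Sum.inl 1)) : ℂ) ≠ 0 := by exact_mod_cast hf
  simp [warpedInv]
  field_simp
  ring

end IsWarpedPatch

end NullFrame

/-! ### Exterior derivatives -/

section ExteriorDerivative

variable {ι : Type*} [Fintype ι] [DecidableEq ι] {g : (ι → ℝ) → Matrix ι ι ℝ}

/-- Torsion-freeness: the Christoffel terms are symmetric in the antisymmetrized pair and drop out.
-/
theorem extD₁_eq (hg : ∀ z a b, g z a b = g z b a) (s : ℝ) (γ : (ι → ℝ) → ι → ℝ)
    (w : (ι → ℝ) → ι → ℂ) (x : ι → ℝ) (a b : ι) :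
    extD₁ s g γ w x a b = pd a (fun z => w z b) x - pd b (fun z => w z a) x
      + ((2 * s * γ x a) • w x b - (2 * s * γ x b) • w x a) := by
  have : ∑ e, christoffel g x e b a • w x e = ∑ e, christoffel g x e a b • w x e :=
    Finset.sum_congr rfl fun e _ => by rw [christoffel_symm hg]
  rw [extD₁, nabla₁, nabla₁, this]
  ring

theorem extD₂_zero_eq (hg : ∀ z a b, g z a b = g z b a) (γ : (ι → ℝ) → ι → ℝ)
    {w : (ι → ℝ) → ι → ι → ℂ} (hw : ∀ z a b, w z a b = -w z b a) (x : ι → ℝ) (a b c : ι) :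
    extD₂ 0 g γ w x a b c = pd a (fun z => w z b c) x + pd b (fun z => w z c a) x
      + pd c (fun z => w z a b) x := by
  have h1 : ∑ e, (christoffel g x e a b • w x e c + christoffel g x e a c • w x b e)
      + ∑ e, (christoffel g x e b c • w x e a + christoffel g x e b a • w x c e)
      + ∑ e, (christoffel g x e c a • w x e b + christoffel g x e c b • w x a e) = 0 := by
    rw [← Finset.sum_add_distrib, ← Finset.sum_add_distrib]
    refine Finset.sum_eq_zero fun e _ => ?_
    rw [christoffel_symm hg x e b a, christoffel_symm hg x e c a, christoffel_symm hg x e c b,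
      hw x b e, hw x c e, hw x a e]
    simp only [smul_neg]
    ring
  simp only [extD₂, nabla₂, mul_zero, zero_mul, zero_smul, add_zero]
  linear_combination -h1

theorem extD₂_zero_antisymm₁ (hg : ∀ z a b, g z a b = g z b a) (γ : (ι → ℝ) → ι → ℝ)
    {w : (ι → ℝ) → ι → ι → ℂ} (hw : ∀ z a b, w z a b = -w z b a) (x : ι → ℝ) (a b c : ι) :
    extD₂ 0 g γ w x a b c = -extD₂ 0 g γ w x b a c := by
  have : ∀ d a b, pd d (fun z => w z a b) x = -pd d (fun z => w z b a) x := fun d a b => by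
    rw [← pd_neg]; simp only [← hw]
  rw [extD₂_zero_eq hg γ hw, extD₂_zero_eq hg γ hw, this a b c, this b c a, this c a b]
  ring

theorem extD₂_zero_antisymm₂ (hg : ∀ z a b, g z a b = g z b a) (γ : (ι → ℝ) → ι → ℝ)
    {w : (ι → ℝ) → ι → ι → ℂ} (hw : ∀ z a b, w z a b = -w z b a) (x : ι → ℝ) (a b c : ι) :
    extD₂ 0 g γ w x a b c = -extD₂ 0 g γ w x a c b := by
  have : ∀ d a b, pd d (fun z => w z a b) x = -pd d (fun z => w z b a) x := fun d a b => by
    rw [← pd_neg]; simp only [← hw]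
  rw [extD₂_zero_eq hg γ hw, extD₂_zero_eq hg γ hw, this a b c, this b c a, this c a b]
  ring

theorem coD₃_antisymm (s : ℝ) (g : (ι → ℝ) → Matrix ι ι ℝ) (γ : (ι → ℝ) → ι → ℝ)
    {T : (ι → ℝ) → ι → ι → ι → ℂ} (hT : ∀ z a b c, T z a b c = -T z a c b) (x : ι → ℝ) (b c : ι) :
    coD₃ s g γ T x b c = -coD₃ s g γ T x c b := by
  have hn : ∀ e a, nabla₃ g T x e a b c = -nabla₃ g T x e a c b := by
    intro e a
    simp only [nabla₃]
    rw [show (fun z => T z a b c) = fun z => -T z a c b from funext fun z => hT z a b c, pd_neg]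
    have h0 : ∑ d, (christoffel g x d e a • T x d b c + christoffel g x d e b • T x a d c
          + christoffel g x d e c • T x a b d)
        + ∑ d, (christoffel g x d e a • T x d c b + christoffel g x d e c • T x a d b
          + christoffel g x d e b • T x a c d) = 0 := by
      rw [← Finset.sum_add_distrib]
      refine Finset.sum_eq_zero fun d _ => ?_
      rw [hT x d b c, hT x a b d, hT x a d c]
      simp only [smul_neg]
      ring
    linear_combination -h0
  simp only [coD₃, neg_neg, ← Finset.sum_neg_distrib]
  refine Finset.sum_congr rfl fun a _ => Finset.sum_congr rfl fun e _ => ?_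
  rw [hn, hT x a b c]
  simp only [smul_neg, ← neg_add, neg_neg]

/-- Contraction with `Z` produces `B_tr - B_rt`; this lets it be read as twice `B_tr`. -/
theorem modLaplaceDeRham_antisymm (hg : ∀ z a b, g z a b = g z b a) (s : ℝ)
    (γ : (ι → ℝ) → ι → ℝ) {w : (ι → ℝ) → ι → ι → ℂ} (hw : ∀ z a b, w z a b = -w z b a)
    (x : ι → ℝ) (a b : ι) :
    modLaplaceDeRham s g γ w x a b = -modLaplaceDeRham s g γ w x b a := by
  rw [modLaplaceDeRham, modLaplaceDeRham,
    coD₃_antisymm s g γ (extD₂_zero_antisymm₂ hg γ hw) x a b, extD₁, extD₁]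
  ring

theorem box_congr_on {S : Set (ι → ℝ)} (hS : IsOpen S) {u v : (ι → ℝ) → ℂ}
    (huv : ∀ z ∈ S, u z = v z) {x : ι → ℝ} (hx : x ∈ S) : box g u x = box g v x := by
  have h1 : ∀ c, ∀ z ∈ S, pd c u z = pd c v z := fun c z hz => pd_congr_on hS huv hz c
  have h2 : ∀ a c, pd a (fun z => pd c u z) x = pd a (fun z => pd c v z) x := fun a c =>
    pd_congr_on hS (h1 c) hx a
  simp only [box, nabla₁, h2, h1 _ x hx]

theorem box_const_mul {S : Set (ι → ℝ)} (hS : IsOpen S) {u : (ι → ℝ) → ℂ}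
    (hu : ∀ z ∈ S, ContDiffAt ℝ 2 u z) (c : ℂ) {x : ι → ℝ} (hx : x ∈ S) :
    box g (fun z => c * u z) x = c * box g u x := by
  have h1 : ∀ a, ∀ z ∈ S, pd a (fun z => c * u z) z = c * pd a u z := fun a z hz =>
    pd_const_mul c ((hu z hz).differentiableAt (by norm_num)) a
  have h2 : ∀ a b, pd a (fun z => pd b (fun z => c * u z) z) x = c * pd a (fun z => pd b u z) x :=
    fun a b => (pd_congr_on hS (h1 b) hx a).trans
      (pd_const_mul c (differentiableAt_pd (hu x hx) b) a)
  simp only [box, nabla₁, h2, h1 _ x hx, Finset.mul_sum, mul_sub, mul_smul_comm]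

end ExteriorDerivative

/-! ### The operators on a warped product -/

section WarpedOperators

variable {n : ℕ}

/-- The divergence of a 1-form on `K` with the metric `h`. -/
def angDiv (h : (Fin n → ℝ) → Matrix (Fin n) (Fin n) ℝ) (A : Fin n → (Idx n → ℝ) → ℂ)
    (x : Idx n → ℝ) : ℂ :=
  ∑ i, ∑ j, invMetric h (ang x) i j •
    (pd (Sum.inr j) (A i) x - ∑ k, christoffel h (ang x) k j i • A k x)

theorem angDiv_add (h : (Fin n → ℝ) → Matrix (Fin n) (Fin n) ℝ)
    {A B : Fin n → (Idx n → ℝ) → ℂ} {x : Idx n → ℝ} (hA : ∀ i, DifferentiableAt ℝ (A i) x)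
    (hB : ∀ i, DifferentiableAt ℝ (B i) x) :
    angDiv h (fun i z => A i z + B i z) x = angDiv h A x + angDiv h B x := by
  simp only [angDiv, pd_add (hA _) (hB _), smul_add, Finset.sum_add_distrib, smul_sub, smul_add,
    Finset.sum_sub_distrib]
  ring

theorem angDiv_sub (h : (Fin n → ℝ) → Matrix (Fin n) (Fin n) ℝ)
    {A B : Fin n → (Idx n → ℝ) → ℂ} {x : Idx n → ℝ} (hA : ∀ i, DifferentiableAt ℝ (A i) x)
    (hB : ∀ i, DifferentiableAt ℝ (B i) x) :
    angDiv h (fun i z => A i z - B i z) x = angDiv h A x - angDiv h B x := by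
  simp only [angDiv, pd_sub (hA _) (hB _), Finset.sum_sub_distrib, smul_sub]
  ring

theorem angDiv_r_smul (h : (Fin n → ℝ) → Matrix (Fin n) (Fin n) ℝ)
    {A : Fin n → (Idx n → ℝ) → ℂ} {x : Idx n → ℝ} (hA : ∀ i, DifferentiableAt ℝ (A i) x) :
    angDiv h (fun i z => z (Sum.inl 1) • A i z) x = x (Sum.inl 1) • angDiv h A x := by
  have h1 : ∀ i j, pd (Sum.inr j) (fun z => z (Sum.inl 1) • A i z) x
      = x (Sum.inl 1) • pd (Sum.inr j) (A i) x := fun i j => by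
    rw [pd_smul (differentiableAt_radial (u := fun r => r) differentiableAt_id) (hA i),
      pd_radial (u := fun r => r) differentiableAt_id]
    simp
  simp only [angDiv, h1, Finset.smul_sum, smul_sub]
  refine Finset.sum_congr rfl fun i _ => Finset.sum_congr rfl fun j _ => ?_
  congr 1
  · rw [smul_comm]
  · refine Finset.sum_congr rfl fun k _ => ?_
    simp only [smul_smul]
    congr 1
    ring

theorem angDiv_congr_on (h : (Fin n → ℝ) → Matrix (Fin n) (Fin n) ℝ) {S : Set (Idx n → ℝ)}
    (hS : IsOpen S) {A B : Fin n → (Idx n → ℝ) → ℂ} (hAB : ∀ i, ∀ z ∈ S, A i z = B i z)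
    {x : Idx n → ℝ} (hx : x ∈ S) : angDiv h A x = angDiv h B x := by
  have h1 : ∀ i j, pd (Sum.inr j) (A i) x = pd (Sum.inr j) (B i) x := fun i j =>
    pd_congr_on hS (hAB i) hx _
  simp only [angDiv, h1, hAB _ x hx]

theorem warpedMetric_symm (f : ℝ → ℝ) {h : (Fin n → ℝ) → Matrix (Fin n) (Fin n) ℝ}
    (hs : ∀ y i j, h y i j = h y j i) (z : Idx n → ℝ) (a b : Idx n) :
    warpedMetric f h z a b = warpedMetric f h z b a := by
  rcases a with a | a <;> rcases b with b | b
  · fin_cases a <;> fin_cases b <;> simp [warpedMetric]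
  · simp [warpedMetric]
  · simp [warpedMetric]
  · simp [warpedMetric, hs _ a b]

/-! ### Codifferentials and wave operator in warped coordinates. -/

namespace IsWarpedPatch

variable {f : ℝ → ℝ} {h : (Fin n → ℝ) → Matrix (Fin n) (Fin n) ℝ} {S : Set (Idx n → ℝ)}
  (H : IsWarpedPatch f h S) {x : Idx n → ℝ} (hx : x ∈ S)

include H hx

theorem differentiableAt_inv_h (i j : Fin n) :
    DifferentiableAt ℝ (fun y => invMetric h y i j) (ang x) :=
  (contDiffAt_invMetric (H.contDiffAt_h x hx) (H.det_ne_zero x hx) i j).differentiableAt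
    (by norm_num)

theorem differentiableAt_angDiv {A : Fin n → (Idx n → ℝ) → ℂ}
    (hA : ∀ i, ContDiffAt ℝ 2 (A i) x) : DifferentiableAt ℝ (angDiv h A) x := by
  unfold angDiv
  refine DifferentiableAt.fun_sum fun i _ => DifferentiableAt.fun_sum fun j _ => ?_
  refine (differentiableAt_angular (H.differentiableAt_inv_h hx i j)).smul
    ((differentiableAt_pd (hA i) _).sub (DifferentiableAt.fun_sum fun k _ => ?_))
  exact (differentiableAt_angular (H.differentiableAt_christoffel_h hx k j i)).smul
    ((hA k).differentiableAt (by norm_num))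

/-- The metric `h` does not depend on `t` and `r`, so `∂_t` and `∂_r` commute with the divergence on
`K`. -/
theorem pd_angDiv {A : Fin n → (Idx n → ℝ) → ℂ} (hA : ∀ i, ContDiffAt ℝ 2 (A i) x) (c : Fin 2) :
    pd (Sum.inl c) (angDiv h A) x = angDiv h (fun i => pd (Sum.inl c) (A i)) x := by
  have hA1 : ∀ i, DifferentiableAt ℝ (A i) x := fun i => (hA i).differentiableAt (by norm_num)
  have hI := fun i j => differentiableAt_angular (H.differentiableAt_inv_h hx i j)
  have hG := fun k i j => differentiableAt_angular (H.differentiableAt_christoffel_h hx k i j)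
  have h1 : ∀ i k, DifferentiableAt ℝ
      (fun z => ∑ l, christoffel h (ang z) l k i • A l z) x := fun i k =>
    DifferentiableAt.fun_sum fun l _ => (hG l k i).fun_smul (hA1 l)
  have h2 : ∀ i j, DifferentiableAt ℝ (fun z => pd (Sum.inr j) (A i) z
      - ∑ k, christoffel h (ang z) k j i • A k z) x := fun i j =>
    (differentiableAt_pd (hA i) _).sub (h1 i j)
  unfold angDiv
  rw [pd_sum _ fun i _ => DifferentiableAt.fun_sum fun j _ => (hI i j).fun_smul (h2 i j)]
  refine Finset.sum_congr rfl fun i _ => ?_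
  rw [pd_sum _ fun j _ => (hI i j).fun_smul (h2 i j)]
  refine Finset.sum_congr rfl fun j _ => ?_
  rw [pd_smul (hI i j) (h2 i j), pd_inl_angular (H.differentiableAt_inv_h hx i j), zero_smul,
    add_zero, pd_sub (differentiableAt_pd (hA i) _) (h1 i j),
    pd_sum _ fun l _ => (hG l j i).fun_smul (hA1 l)]
  congr 2
  · exact pd_comm (hA i) _ _
  · refine Finset.sum_congr rfl fun k _ => ?_
    rw [pd_smul (hG k j i) (hA1 k), pd_inl_angular (H.differentiableAt_christoffel_h hx k j i),
      zero_smul, add_zero]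

theorem sum_inv_smul_antisymm {B : Fin n → Fin n → ℂ} (hB : ∀ i j, B i j = -B j i) :
    ∑ i, ∑ j, invMetric h (ang x) i j • B i j = 0 := by
  have h1 : ∑ i, ∑ j, invMetric h (ang x) i j • B i j
      = -∑ i, ∑ j, invMetric h (ang x) i j • B i j := by
    conv_lhs => rw [Finset.sum_comm]
    simp only [← Finset.sum_neg_distrib]
    refine Finset.sum_congr rfl fun i _ => Finset.sum_congr rfl fun j _ => ?_
    rw [H.inv_symm hx i j, hB j i, smul_neg]
  exact self_eq_neg.1 h1

theorem sum_inv_mul_h_smul (c : ℂ) :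
    ∑ i, ∑ j, invMetric h (ang x) i j • (h (ang x) i j • c) = (n : ℝ) • c := by
  simp only [smul_smul, ← Finset.sum_smul, H.trace_inv_mul hx]

/-- Common shape of the angular traces below: a divergence on `K`, a pure trace `h_ij c` coming from
`Γ^r_{ij}`, which contributes `n c`, and an antisymmetric `B` coming from `Γ^k_{jr} = δ^k_j / r`,
which vanishes under the trace. -/
theorem sum_warpedInv {N B : Fin n → Fin n → ℂ} {A : Fin n → (Idx n → ℝ) → ℂ} {σ c : ℂ}
    (hN : ∀ i j, N i j = σ * (pd (Sum.inr j) (A i) x - ∑ k, christoffel h (ang x) k j i • A k x)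
      + (h (ang x) i j • c + B i j)) (hB : ∀ i j, B i j = -B j i) :
    ∑ i, ∑ j, ((x (Sum.inl 1) : ℂ) ^ 2)⁻¹ * (invMetric h (ang x) i j : ℂ) * N i j
      = ((x (Sum.inl 1) : ℂ) ^ 2)⁻¹ * (σ * angDiv h A x + n * c) := by
  have h1 := H.sum_inv_mul_h_smul hx c
  have h2 := H.sum_inv_smul_antisymm hx hB
  have h3 : σ * angDiv h A x + n * c = σ * angDiv h A x
      + (∑ i, ∑ j, invMetric h (ang x) i j • (h (ang x) i j • c)
        + ∑ i, ∑ j, invMetric h (ang x) i j • B i j) := by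
    rw [h1, h2]; simp
  rw [h3, angDiv]
  simp only [Finset.mul_sum, ← Finset.sum_add_distrib]
  refine Finset.sum_congr rfl fun i _ => Finset.sum_congr rfl fun j _ => ?_
  rw [hN i j]
  simp only [Complex.real_smul]
  ring

theorem coD₂_t (γ : (Idx n → ℝ) → Idx n → ℝ) {w : (Idx n → ℝ) → Idx n → Idx n → ℂ}
    (hw : ∀ z a b, w z a b = -w z b a) :
    coD₂ 0 (warpedMetric f h) γ w x (Sum.inl 0)
      = f (x (Sum.inl 1)) • pd (Sum.inl 1) (fun z => w z (Sum.inl 0) (Sum.inl 1)) x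
        + (n * f (x (Sum.inl 1)) / x (Sum.inl 1)) • w x (Sum.inl 0) (Sum.inl 1)
        + (x (Sum.inl 1) ^ 2)⁻¹ • angDiv h (fun i z => w z (Sum.inl 0) (Sum.inr i)) x := by
  have hf : (f (x (Sum.inl 1)) : ℂ) ≠ 0 := by exact_mod_cast H.f_ne hx
  have hr : (x (Sum.inl 1) : ℂ) ≠ 0 := by exact_mod_cast H.r_ne hx
  have hself : ∀ a, w x a a = 0 := fun a => self_eq_neg.1 (hw x a a)
  have hpd : ∀ d a b, pd d (fun z => w z a b) x = -pd d (fun z => w z b a) x := fun d a b => by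
    rw [← pd_neg]; simp only [← hw]
  have hpself : ∀ d a, pd d (fun z => w z a a) x = 0 := fun d a => self_eq_neg.1 (hpd d a a)
  have hang : ∀ i j, nabla₂ (warpedMetric f h) w x (Sum.inr j) (Sum.inr i) (Sum.inl 0)
      = -1 * (pd (Sum.inr j) (fun z => w z (Sum.inl 0) (Sum.inr i)) x
        - ∑ k, christoffel h (ang x) k j i • w x (Sum.inl 0) (Sum.inr k))
        + (h (ang x) i j • (-(x (Sum.inl 1) * f (x (Sum.inl 1)) * w x (Sum.inl 0) (Sum.inl 1)))
          + 0) := by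
    intro i j
    simp only [nabla₂, Fintype.sum_sum_type, Fin.sum_univ_two, H.christoffel_eq hx]
    simp [warpedChristoffel, hpd _ (Sum.inr i), hw x (Sum.inr _) (Sum.inl 0),
      hw x (Sum.inl 1) (Sum.inl 0), H.symm _ j i]
    ring
  have htt : nabla₂ (warpedMetric f h) w x (Sum.inl 0) (Sum.inl 0) (Sum.inl 0) = 0 := by
    simp [nabla₂, H.christoffel_eq hx, warpedChristoffel, hself, hpself,
      hw x (Sum.inl 1) (Sum.inl 0)]
  have hrr : nabla₂ (warpedMetric f h) w x (Sum.inl 1) (Sum.inl 1) (Sum.inl 0)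
      = -pd (Sum.inl 1) (fun z => w z (Sum.inl 0) (Sum.inl 1)) x := by
    simp [nabla₂, H.christoffel_eq hx, warpedChristoffel, hself, hpd _ (Sum.inl 1) (Sum.inl 0),
      hw x (Sum.inl 1) (Sum.inl 0)]
  simp only [coD₂, Fintype.sum_sum_type, Fin.sum_univ_two, H.invMetric_eq hx, mul_zero, zero_mul,
    zero_smul, add_zero, htt, hrr]
  simp [warpedInv]
  rw [H.sum_warpedInv hx (A := fun i z => w z (Sum.inl 0) (Sum.inr i)) (B := fun _ _ => 0) hang
    (by simp)]
  field_simp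
  ring

theorem coD₂_r (γ : (Idx n → ℝ) → Idx n → ℝ) {w : (Idx n → ℝ) → Idx n → Idx n → ℂ}
    (hw : ∀ z a b, w z a b = -w z b a) :
    coD₂ 0 (warpedMetric f h) γ w x (Sum.inl 1)
      = (f (x (Sum.inl 1)))⁻¹ • pd (Sum.inl 0) (fun z => w z (Sum.inl 0) (Sum.inl 1)) x
        + (x (Sum.inl 1) ^ 2)⁻¹ • angDiv h (fun i z => w z (Sum.inl 1) (Sum.inr i)) x := by
  have hf : (f (x (Sum.inl 1)) : ℂ) ≠ 0 := by exact_mod_cast H.f_ne hx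
  have hr : (x (Sum.inl 1) : ℂ) ≠ 0 := by exact_mod_cast H.r_ne hx
  have hself : ∀ a, w x a a = 0 := fun a => self_eq_neg.1 (hw x a a)
  have hpd : ∀ d a b, pd d (fun z => w z a b) x = -pd d (fun z => w z b a) x := fun d a b => by
    rw [← pd_neg]; simp only [← hw]
  have hpself : ∀ d a, pd d (fun z => w z a a) x = 0 := fun d a => self_eq_neg.1 (hpd d a a)
  have hang : ∀ i j, nabla₂ (warpedMetric f h) w x (Sum.inr j) (Sum.inr i) (Sum.inl 1)
      = -1 * (pd (Sum.inr j) (fun z => w z (Sum.inl 1) (Sum.inr i)) x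
        - ∑ k, christoffel h (ang x) k j i • w x (Sum.inl 1) (Sum.inr k))
        + (h (ang x) i j • (0 : ℂ) + -((x (Sum.inl 1) : ℂ)⁻¹ * w x (Sum.inr i) (Sum.inr j))) := by
    intro i j
    simp only [nabla₂, Fintype.sum_sum_type, Fin.sum_univ_two, H.christoffel_eq hx]
    simp [warpedChristoffel, hpd _ (Sum.inr i), hw x (Sum.inr _) (Sum.inl 1), hself,
      Finset.sum_add_distrib]
    ring
  have htt : nabla₂ (warpedMetric f h) w x (Sum.inl 0) (Sum.inl 0) (Sum.inl 1)
      = pd (Sum.inl 0) (fun z => w z (Sum.inl 0) (Sum.inl 1)) x := by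
    simp [nabla₂, H.christoffel_eq hx, warpedChristoffel, hself]
  have hrr : nabla₂ (warpedMetric f h) w x (Sum.inl 1) (Sum.inl 1) (Sum.inl 1) = 0 := by
    simp [nabla₂, H.christoffel_eq hx, warpedChristoffel, hself, hpself]
  simp only [coD₂, Fintype.sum_sum_type, Fin.sum_univ_two, H.invMetric_eq hx, mul_zero, zero_mul,
    zero_smul, add_zero, htt, hrr]
  simp [warpedInv]
  rw [H.sum_warpedInv hx (A := fun i z => w z (Sum.inl 1) (Sum.inr i)) hang fun i j => by
    rw [hw x (Sum.inr i) (Sum.inr j)]; ring]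
  field_simp
  ring

/-- Neither `s` nor `γ` survives: `γ` points along `dr`, and `T_{rtr} = 0`. -/
theorem coD₃_tr {γ : (Idx n → ℝ) → Idx n → ℝ} (hγ : ∀ a, a ≠ Sum.inl 1 → γ x a = 0) (s : ℝ)
    {T : (Idx n → ℝ) → Idx n → Idx n → Idx n → ℂ} (hT₁ : ∀ z a b c, T z a b c = -T z b a c)
    (hT₂ : ∀ z a b c, T z a b c = -T z a c b) :
    coD₃ s (warpedMetric f h) γ T x (Sum.inl 0) (Sum.inl 1)
      = -((x (Sum.inl 1) ^ 2)⁻¹ •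
        angDiv h (fun i z => T z (Sum.inr i) (Sum.inl 0) (Sum.inl 1)) x) := by
  have hs₁ : ∀ z a b, T z a a b = 0 := fun z a b => self_eq_neg.1 (hT₁ z a a b)
  have hs₂ : ∀ z a b, T z b a a = 0 := fun z a b => self_eq_neg.1 (hT₂ z b a a)
  have hs₃ : ∀ z a b, T z a b a = 0 := fun z a b => by rw [hT₂, hs₁, neg_zero]
  have hang : ∀ i j, nabla₃ (warpedMetric f h) T x (Sum.inr j) (Sum.inr i) (Sum.inl 0) (Sum.inl 1)
      = 1 * (pd (Sum.inr j) (fun z => T z (Sum.inr i) (Sum.inl 0) (Sum.inl 1)) x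
        - ∑ k, christoffel h (ang x) k j i • T x (Sum.inr k) (Sum.inl 0) (Sum.inl 1))
        + (h (ang x) i j • (0 : ℂ)
          + -((x (Sum.inl 1) : ℂ)⁻¹ * T x (Sum.inr i) (Sum.inl 0) (Sum.inr j))) := by
    intro i j
    simp only [nabla₃, Fintype.sum_sum_type, Fin.sum_univ_two, H.christoffel_eq hx]
    simp [warpedChristoffel, hs₁, hs₂, hs₃, Finset.sum_add_distrib]
    ring
  have htt : nabla₃ (warpedMetric f h) T x (Sum.inl 0) (Sum.inl 0) (Sum.inl 0) (Sum.inl 1)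
      = 0 := by
    simp [nabla₃, H.christoffel_eq hx, warpedChristoffel, hs₁, hs₂, hs₃]
  have hrr : nabla₃ (warpedMetric f h) T x (Sum.inl 1) (Sum.inl 1) (Sum.inl 0) (Sum.inl 1)
      = 0 := by
    simp [nabla₃, H.christoffel_eq hx, warpedChristoffel, hs₁, hs₂, hs₃]
  have hγi : ∀ i, γ x (Sum.inr i) = 0 := fun i => hγ _ (by simp)
  simp only [coD₃, Fintype.sum_sum_type, Fin.sum_univ_two, H.invMetric_eq hx, htt, hrr, hγi,
    mul_zero, zero_smul, add_zero]
  simp [warpedInv, hs₁, hs₃]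
  rw [H.sum_warpedInv hx (A := fun i z => T z (Sum.inr i) (Sum.inl 0) (Sum.inl 1)) hang
    fun i j => by
      rw [hT₁ x (Sum.inr i), hT₂ x (Sum.inl 0), hT₁ x (Sum.inl 0)]; ring]
  simp

theorem box_eq {u : (Idx n → ℝ) → ℂ} (hu : ContDiffAt ℝ 2 u x) :
    box (warpedMetric f h) u x
      = f (x (Sum.inl 1)) • pd (Sum.inl 1) (pd (Sum.inl 1) u) x
        - (f (x (Sum.inl 1)))⁻¹ • pd (Sum.inl 0) (pd (Sum.inl 0) u) x
        + (deriv f (x (Sum.inl 1)) + n * f (x (Sum.inl 1)) / x (Sum.inl 1)) • pd (Sum.inl 1) u x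
        + (x (Sum.inl 1) ^ 2)⁻¹ • angDiv h (fun i => pd (Sum.inr i) u) x := by
  have hf : (f (x (Sum.inl 1)) : ℂ) ≠ 0 := by exact_mod_cast H.f_ne hx
  have hr : (x (Sum.inl 1) : ℂ) ≠ 0 := by exact_mod_cast H.r_ne hx
  have hang : ∀ i j, nabla₁ (warpedMetric f h) (fun z c => pd c u z) x (Sum.inr i) (Sum.inr j)
      = 1 * (pd (Sum.inr j) (pd (Sum.inr i) u) x
        - ∑ k, christoffel h (ang x) k j i • pd (Sum.inr k) u x)
        + (h (ang x) i j • ((x (Sum.inl 1) : ℂ) * f (x (Sum.inl 1)) * pd (Sum.inl 1) u x) + 0) := by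
    intro i j
    simp only [nabla₁, Fintype.sum_sum_type, Fin.sum_univ_two, H.christoffel_eq hx]
    rw [pd_comm hu (Sum.inr j)]
    simp [warpedChristoffel, christoffel_symm H.symm _ _ i j]
    ring
  have htt : nabla₁ (warpedMetric f h) (fun z c => pd c u z) x (Sum.inl 0) (Sum.inl 0)
      = pd (Sum.inl 0) (pd (Sum.inl 0) u) x
        - (f (x (Sum.inl 1)) * deriv f (x (Sum.inl 1)) / 2 : ℝ) • pd (Sum.inl 1) u x := by
    simp [nabla₁, H.christoffel_eq hx, warpedChristoffel]
  have hrr : nabla₁ (warpedMetric f h) (fun z c => pd c u z) x (Sum.inl 1) (Sum.inl 1)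
      = pd (Sum.inl 1) (pd (Sum.inl 1) u) x
        + (deriv f (x (Sum.inl 1)) / (2 * f (x (Sum.inl 1))) : ℝ) • pd (Sum.inl 1) u x := by
    simp [nabla₁, H.christoffel_eq hx, warpedChristoffel]
  simp only [box, Fintype.sum_sum_type, Fin.sum_univ_two, H.invMetric_eq hx, htt, hrr]
  simp [warpedInv]
  rw [H.sum_warpedInv hx (A := fun i => pd (Sum.inr i) u) (B := fun _ _ => 0) hang (by simp)]
  field_simp
  ring

end IsWarpedPatch

end WarpedOperators

/-! ### The decoupled equation on a warped product -/

section Decoupling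

variable {n : ℕ}

theorem pd_radial_smul {u : ℝ → ℝ} {ψ : (Idx n → ℝ) → ℂ} {x : Idx n → ℝ}
    (hu : DifferentiableAt ℝ u (x (Sum.inl 1))) (hψ : DifferentiableAt ℝ ψ x) (a : Idx n) :
    pd a (fun z => u (z (Sum.inl 1)) • ψ z) x = u (x (Sum.inl 1)) • pd a ψ x
      + (if a = Sum.inl 1 then deriv u (x (Sum.inl 1)) else 0) • ψ x := by
  rw [pd_smul (differentiableAt_radial hu) hψ, pd_radial hu]

theorem pd_r_smul {ψ : (Idx n → ℝ) → ℂ} {x : Idx n → ℝ} (hψ : DifferentiableAt ℝ ψ x)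
    (a : Idx n) :
    pd a (fun z => z (Sum.inl 1) • ψ z) x = x (Sum.inl 1) • pd a ψ x
      + (if a = Sum.inl 1 then (1 : ℝ) else 0) • ψ x := by
  simpa using pd_radial_smul (u := fun r => r) differentiableAt_id hψ a

namespace IsWarpedPatch

variable {f : ℝ → ℝ} {h : (Fin n → ℝ) → Matrix (Fin n) (Fin n) ℝ} {S : Set (Idx n → ℝ)}
  (H : IsWarpedPatch f h S) {x : Idx n → ℝ} (hx : x ∈ S)

include H hx

theorem box_r_smul {φ : (Idx n → ℝ) → ℂ} (hφ : ∀ z ∈ S, ContDiffAt ℝ 2 φ z) :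
    box (warpedMetric f h) (fun z => z (Sum.inl 1) • φ z) x
      = f (x (Sum.inl 1)) • (x (Sum.inl 1) • pd (Sum.inl 1) (pd (Sum.inl 1) φ) x
          + (2 : ℝ) • pd (Sum.inl 1) φ x)
        - (f (x (Sum.inl 1)))⁻¹ • (x (Sum.inl 1) • pd (Sum.inl 0) (pd (Sum.inl 0) φ) x)
        + (deriv f (x (Sum.inl 1)) + n * f (x (Sum.inl 1)) / x (Sum.inl 1))
          • (x (Sum.inl 1) • pd (Sum.inl 1) φ x + φ x)
        + (x (Sum.inl 1))⁻¹ • angDiv h (fun i => pd (Sum.inr i) φ) x := by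
  have hφ1 : ∀ z ∈ S, DifferentiableAt ℝ φ z := fun z hz => (hφ z hz).differentiableAt (by norm_num)
  have hd : ∀ a, DifferentiableAt ℝ (pd a φ) x := fun a => differentiableAt_pd (hφ x hx) a
  have hr2 : ContDiffAt ℝ 2 (fun z : Idx n → ℝ => z (Sum.inl 1)) x := by fun_prop
  have htt : pd (Sum.inl 0) (pd (Sum.inl 0) fun z => z (Sum.inl 1) • φ z) x
      = x (Sum.inl 1) • pd (Sum.inl 0) (pd (Sum.inl 0) φ) x := by
    rw [pd_congr_on H.isOpen (fun z hz => pd_r_smul (hφ1 z hz) (Sum.inl 0)) hx]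
    simp only [Sum.inl.injEq, zero_ne_one, if_false, zero_smul, add_zero]
    rw [pd_r_smul (hd _)]
    simp
  have hrr : pd (Sum.inl 1) (pd (Sum.inl 1) fun z => z (Sum.inl 1) • φ z) x
      = x (Sum.inl 1) • pd (Sum.inl 1) (pd (Sum.inl 1) φ) x + (2 : ℝ) • pd (Sum.inl 1) φ x := by
    rw [pd_congr_on H.isOpen (fun z hz => pd_r_smul (hφ1 z hz) (Sum.inl 1)) hx]
    simp only [if_true, one_smul]
    rw [pd_add ((differentiableAt_radial (u := fun r => r) differentiableAt_id).fun_smul (hd _))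
      (hφ1 x hx), pd_r_smul (hd _)]
    simp
    ring
  have hang : angDiv h (fun i => pd (Sum.inr i) fun z => z (Sum.inl 1) • φ z) x
      = x (Sum.inl 1) • angDiv h (fun i => pd (Sum.inr i) φ) x := by
    rw [← angDiv_r_smul h fun i => hd _]
    refine angDiv_congr_on h H.isOpen (fun i z hz => ?_) hx
    rw [pd_r_smul (hφ1 z hz)]
    simp
  have hr : (x (Sum.inl 1) : ℂ) ≠ 0 := by exact_mod_cast H.r_ne hx
  have hu : ContDiffAt ℝ 2 (fun z => z (Sum.inl 1) • φ z) x := hr2.smul (hφ x hx)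
  rw [H.box_eq hx hu, htt, hrr, hang, pd_r_smul (hφ1 x hx)]
  simp
  field_simp

/-- The `(t, r)` component of the spin `1` modified Laplace-de Rham operator decouples. -/
theorem r_smul_modLaplaceDeRham_tr {γ : (Idx n → ℝ) → Idx n → ℝ}
    (hγ : ∀ a, γ x a = if a = Sum.inl 1 then (x (Sum.inl 1))⁻¹ else 0)
    {w : (Idx n → ℝ) → Idx n → Idx n → ℂ} (hw : ∀ z a b, w z a b = -w z b a)
    (hC : ∀ z ∈ S, ∀ a b, ContDiffAt ℝ 2 (fun z => w z a b) z) :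
    -(x (Sum.inl 1) • modLaplaceDeRham 1 (warpedMetric f h) γ w x (Sum.inl 0) (Sum.inl 1))
      = box (warpedMetric f h) (fun z => z (Sum.inl 1) • w z (Sum.inl 0) (Sum.inl 1)) x
        + (((n : ℝ) - 1) * deriv f (x (Sum.inl 1)) / x (Sum.inl 1))
          • (x (Sum.inl 1) • w x (Sum.inl 0) (Sum.inl 1)) := by
  have hs := warpedMetric_symm f H.symm
  have hf := H.f_ne hx
  have hr := H.r_ne hx
  have hdf := H.differentiableAt_f hx
  have hd : ∀ a b, DifferentiableAt ℝ (fun z => w z a b) x := fun a b =>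
    (hC x hx a b).differentiableAt (by norm_num)
  have hdd : ∀ c a b, DifferentiableAt ℝ (pd c fun z => w z a b) x := fun c a b =>
    differentiableAt_pd (hC x hx a b) c
  have hinv : HasDerivAt (fun r : ℝ => (r ^ 2)⁻¹) (-(2 * x (Sum.inl 1))
      / (x (Sum.inl 1) ^ 2) ^ 2) (x (Sum.inl 1)) := by
    simpa using (hasDerivAt_pow 2 (x (Sum.inl 1))).fun_inv (pow_ne_zero 2 hr)
  have hnf := ((hdf.hasDerivAt.const_mul (n : ℝ)).fun_div (hasDerivAt_id (x (Sum.inl 1))) hr)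
  simp only [id] at hnf
  have hfi : DifferentiableAt ℝ (fun r => (f r)⁻¹) (x (Sum.inl 1)) := hdf.fun_inv hf
  have hA := H.differentiableAt_angDiv hx (A := fun i z => w z (Sum.inl 0) (Sum.inr i))
    fun i => hC x hx _ _
  have hB := H.differentiableAt_angDiv hx (A := fun i z => w z (Sum.inl 1) (Sum.inr i))
    fun i => hC x hx _ _
  have hJr : pd (Sum.inl 0) (fun z => coD₂ 0 (warpedMetric f h) γ w z (Sum.inl 1)) x
      = (f (x (Sum.inl 1)))⁻¹ •
          pd (Sum.inl 0) (pd (Sum.inl 0) fun z => w z (Sum.inl 0) (Sum.inl 1)) x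
        + (x (Sum.inl 1) ^ 2)⁻¹ •
          angDiv h (fun i => pd (Sum.inl 0) fun z => w z (Sum.inl 1) (Sum.inr i)) x := by
    rw [pd_congr_on H.isOpen (fun z hz => H.coD₂_r hz γ hw) hx,
      pd_add ((differentiableAt_radial hfi).fun_smul (hdd _ _ _))
        ((differentiableAt_radial hinv.differentiableAt).fun_smul hB),
      pd_radial_smul (u := fun r => (f r)⁻¹) hfi (hdd _ _ _),
      pd_radial_smul (u := fun r => (r ^ 2)⁻¹) hinv.differentiableAt hB,
      H.pd_angDiv hx fun i => hC x hx _ _]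
    simp
  have hJt : pd (Sum.inl 1) (fun z => coD₂ 0 (warpedMetric f h) γ w z (Sum.inl 0)) x
      = f (x (Sum.inl 1)) •
          pd (Sum.inl 1) (pd (Sum.inl 1) fun z => w z (Sum.inl 0) (Sum.inl 1)) x
        + deriv f (x (Sum.inl 1)) • pd (Sum.inl 1) (fun z => w z (Sum.inl 0) (Sum.inl 1)) x
        + ((n * f (x (Sum.inl 1)) / x (Sum.inl 1)) •
            pd (Sum.inl 1) (fun z => w z (Sum.inl 0) (Sum.inl 1)) x
          + ((n * deriv f (x (Sum.inl 1)) * x (Sum.inl 1) - n * f (x (Sum.inl 1)))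
            / x (Sum.inl 1) ^ 2) • w x (Sum.inl 0) (Sum.inl 1))
        + ((x (Sum.inl 1) ^ 2)⁻¹ •
            angDiv h (fun i => pd (Sum.inl 1) fun z => w z (Sum.inl 0) (Sum.inr i)) x
          + (-(2 * x (Sum.inl 1)) / (x (Sum.inl 1) ^ 2) ^ 2) •
            angDiv h (fun i z => w z (Sum.inl 0) (Sum.inr i)) x) := by
    rw [pd_congr_on H.isOpen (fun z hz => H.coD₂_t hz γ hw) hx,
      pd_add (((differentiableAt_radial hdf).fun_smul (hdd _ _ _)).fun_add
          ((differentiableAt_radial hnf.differentiableAt).fun_smul (hd _ _)))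
        ((differentiableAt_radial hinv.differentiableAt).fun_smul hA),
      pd_add ((differentiableAt_radial hdf).fun_smul (hdd _ _ _))
          ((differentiableAt_radial hnf.differentiableAt).fun_smul (hd _ _)),
      pd_radial_smul (u := f) hdf (hdd _ _ _),
      pd_radial_smul (u := fun r => n * f r / r) hnf.differentiableAt (hd _ _),
      pd_radial_smul (u := fun r => (r ^ 2)⁻¹) hinv.differentiableAt hA,
      H.pd_angDiv hx fun i => hC x hx _ _, hinv.deriv, hnf.deriv]
    simp
  -- The last two divergences are those of `hJr` and `hJt`; they cancel once the sign in `coD₃_tr`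
  -- is taken into account.
  have hH : angDiv h (fun i z => extD₂ 0 (warpedMetric f h) γ w z (Sum.inr i) (Sum.inl 0)
        (Sum.inl 1)) x
      = angDiv h (fun i => pd (Sum.inr i) fun z => w z (Sum.inl 0) (Sum.inl 1)) x
        + angDiv h (fun i => pd (Sum.inl 0) fun z => w z (Sum.inl 1) (Sum.inr i)) x
        - angDiv h (fun i => pd (Sum.inl 1) fun z => w z (Sum.inl 0) (Sum.inr i)) x := by
    rw [← angDiv_add h (fun i => hdd _ _ _) (fun i => hdd _ _ _),
      ← angDiv_sub h (fun i => (hdd _ _ _).fun_add (hdd _ _ _)) (fun i => hdd _ _ _)]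
    refine angDiv_congr_on h H.isOpen (fun i z _ => ?_) hx
    rw [extD₂_zero_eq hs γ hw, show (fun z => w z (Sum.inr i) (Sum.inl 0))
      = fun z => -w z (Sum.inl 0) (Sum.inr i) from funext fun z => hw _ _ _, pd_neg]
    ring
  -- The `γ` term `-(2/r) J_t` removes the `2 r⁻³ div w_t·` left by differentiating `r⁻²` in `J_t`.
  -- The coefficients of `w_tr` are then `n f' + n f/r` on the left and `f' + n f/r` in the wave
  -- operator; their difference is the potential `(n-1) f'`.
  rw [modLaplaceDeRham, extD₁_eq hs, hJr, hJt, H.coD₂_t hx γ hw,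
    H.coD₃_tr hx (fun a ha => by rw [hγ, if_neg ha]) 1 (extD₂_zero_antisymm₁ hs γ hw)
      (extD₂_zero_antisymm₂ hs γ hw), hH, H.box_r_smul hx fun z hz => hC z hz _ _]
  have hfc : (f (x (Sum.inl 1)) : ℂ) ≠ 0 := by exact_mod_cast hf
  have hrc : (x (Sum.inl 1) : ℂ) ≠ 0 := by exact_mod_cast hr
  simp only [hγ]
  simp
  field_simp
  ring

end IsWarpedPatch

end Decoupling

/-! ### The metric of `K` in a chart -/

section ChartMetric

variable {n : ℕ} {K : Type*} [TopologicalSpace K] [ChartedSpace (EuclideanSpace ℝ (Fin n)) K]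
  [IsManifold (𝓡 n) ∞ K]

theorem kMetric_symm (gK : RMetric n K) (φ : OpenPartialHomeomorph K (EuclideanSpace ℝ (Fin n)))
    (y : Fin n → ℝ) (i j : Fin n) : kMetric gK φ y i j = kMetric gK φ y j i :=
  gK.symm _ _ _

/-- The coordinate field is the tangent map of `φ.symm` applied to a constant field of the model
space, hence smooth because charts of the maximal atlas are. -/
theorem contMDiffAt_kVec {φ : OpenPartialHomeomorph K (EuclideanSpace ℝ (Fin n))}
    (hφ : φ ∈ IsManifold.maximalAtlas (𝓡 n) ∞ K) {y : Fin n → ℝ}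
    (hy : (WithLp.toLp 2 y : EuclideanSpace ℝ (Fin n)) ∈ φ.target) (i : Fin n) :
    ContMDiffAt 𝓘(ℝ, Fin n → ℝ) ((𝓡 n).prod (𝓡 n)) ∞
      (fun z => TotalSpace.mk' (EuclideanSpace ℝ (Fin n))
        (E := fun y : K => TangentSpace (𝓡 n) y) (kPoint φ z) (kVec φ z i)) y := by
  have h1 := (contMDiffOn_symm_of_mem_maximalAtlas hφ).contMDiffOn_tangentMapWithin
    (m := ∞) (by simp) φ.open_target.uniqueMDiffOn
  have h2 : ContMDiffAt 𝓘(ℝ, Fin n → ℝ) ((𝓡 n).prod (𝓡 n)) ∞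
      (fun z : Fin n → ℝ => (⟨WithLp.toLp 2 z, EuclideanSpace.single i (1 : ℝ)⟩ :
        TangentBundle (𝓡 n) (EuclideanSpace ℝ (Fin n)))) y := by
    rw [contMDiffAt_totalSpace]
    refine ⟨?_, ?_⟩
    · exact (PiLp.contDiff_toLp (𝕜 := ℝ) (p := 2)).contMDiff.contMDiffAt
    · refine (contMDiffAt_const (c := (EuclideanSpace.single i (1 : ℝ) :
        EuclideanSpace ℝ (Fin n)))).congr_of_eventuallyEq (Filter.Eventually.of_forall fun z => ?_)
      simp only [TangentBundle.trivializationAt_apply]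
      exact DFunLike.congr_fun (fderivWithin_id (𝕜 := ℝ) (s := Set.range (𝓡 n))
        (by rw [ModelWithCorners.range_eq_univ]; exact uniqueDiffWithinAt_univ)) _
  have h3 := (h1 (⟨WithLp.toLp 2 y, EuclideanSpace.single i (1 : ℝ)⟩ :
    TangentBundle (𝓡 n) (EuclideanSpace ℝ (Fin n))) hy).contMDiffAt
    ((φ.open_target.preimage (FiberBundle.continuous_proj _ _)).mem_nhds hy)
  have h4 := ContMDiffAt.comp y h3 h2
  refine h4.congr_of_eventuallyEq ?_
  have hc : Continuous fun z : Fin n → ℝ => (WithLp.toLp 2 z : EuclideanSpace ℝ (Fin n)) :=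
    (PiLp.contDiff_toLp (𝕜 := ℝ) (p := 2) (n := 0)).continuous
  filter_upwards [hc.continuousAt (φ.open_target.mem_nhds hy)] with z hz
  simp only [Function.comp, tangentMapWithin, kPoint, kVec]
  rw [mfderivWithin_of_isOpen φ.open_target hz]

theorem contDiffAt_kMetric (gK : RMetric n K)
    {φ : OpenPartialHomeomorph K (EuclideanSpace ℝ (Fin n))}
    (hφ : φ ∈ IsManifold.maximalAtlas (𝓡 n) ∞ K) {y : Fin n → ℝ}
    (hy : (WithLp.toLp 2 y : EuclideanSpace ℝ (Fin n)) ∈ φ.target) (i j : Fin n) :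
    ContDiffAt ℝ ∞ (fun z => kMetric gK φ z i j) y := by
  have hb : ContMDiffAt 𝓘(ℝ, Fin n → ℝ) (𝓡 n) ∞ (kPoint φ) y :=
    (contMDiffAt_totalSpace.1 (contMDiffAt_kVec hφ hy i)).1
  have := ContMDiffAt.clm_bundle_apply₂ (E₃ := Bundle.Trivial K ℝ)
    (gK.contMDiff.contMDiffAt.comp y hb)
    (contMDiffAt_kVec hφ hy i) (contMDiffAt_kVec hφ hy j)
  rw [contMDiffAt_totalSpace] at this
  exact this.2.contDiffAt

/-- A kernel vector `v` of the matrix would give a tangent vector `∑ v_i ∂_i` of length zero;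
positivity makes it zero, and injectivity of the differential of `φ.symm` then forces `v = 0`. -/
theorem det_kMetric_ne_zero (gK : RMetric n K)
    {φ : OpenPartialHomeomorph K (EuclideanSpace ℝ (Fin n))}
    (hφ : φ ∈ IsManifold.maximalAtlas (𝓡 n) ∞ K) {y : Fin n → ℝ}
    (hy : (WithLp.toLp 2 y : EuclideanSpace ℝ (Fin n)) ∈ φ.target) :
    (kMetric gK φ y).det ≠ 0 := by
  intro h0
  obtain ⟨v, hv, hmul⟩ := Matrix.exists_mulVec_eq_zero_iff.2 h0
  have hd : φ.symm.MDifferentiable (𝓡 n) (𝓡 n) :=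
    ⟨(contMDiffOn_symm_of_mem_maximalAtlas hφ).mdifferentiableOn (by simp),
      (contMDiffOn_of_mem_maximalAtlas hφ).mdifferentiableOn (by simp)⟩
  have hsum : ∑ i, ∑ j, v i * v j * kMetric gK φ y i j = 0 := by
    have : ∀ i, ∑ j, v i * v j * kMetric gK φ y i j = v i * (kMetric gK φ y).mulVec v i := by
      intro i
      simp only [Matrix.mulVec, dotProduct, Finset.mul_sum]
      exact Finset.sum_congr rfl fun j _ => by ring
    simp [this, hmul]
  have hin : gK.inner (kPoint φ y) (∑ i, v i • kVec φ y i) (∑ i, v i • kVec φ y i) = 0 := by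
    rw [← hsum]
    simp only [map_sum, map_smul, _root_.sum_apply,
      _root_.smul_apply, smul_eq_mul, kMetric, Matrix.of_apply]
    rw [Finset.sum_comm]
    simp only [Finset.mul_sum]
    exact Finset.sum_congr rfl fun j _ => Finset.sum_congr rfl fun i _ => by ring
  have hz : ∑ i, v i • kVec φ y i = 0 := by
    by_contra hne
    exact (gK.pos _ _ hne).ne' hin
  have hz' : mfderiv (𝓡 n) (𝓡 n) φ.symm (WithLp.toLp 2 y)
      (∑ i, v i • EuclideanSpace.single i (1 : ℝ)) = 0 := by
    refine Eq.trans ?_ hz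
    refine (map_sum _ _ _).trans (Finset.sum_congr rfl fun i _ => ?_)
    exact map_smul _ _ _
  have h1 : (∑ i, v i • EuclideanSpace.single i (1 : ℝ) : EuclideanSpace ℝ (Fin n)) = 0 :=
    (hd.mfderiv_injective hy) (hz'.trans (map_zero _).symm)
  apply hv
  funext i
  have := congrArg (fun w : EuclideanSpace ℝ (Fin n) => w i) h1
  simpa [WithLp.ofLp_sum, Finset.sum_apply, Pi.single_apply] using this

end ChartMetric

/-! ### The static black hole -/

/-! ### Derivatives of the lapse function. -/

section Lapse

variable {n : ℕ} {κ M lam : ℝ}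

theorem hasDerivAt_lapse (hn : 1 ≤ n) {r : ℝ} (hr : r ≠ 0) :
    HasDerivAt (lapse n κ M lam) (2 * M * ((n : ℝ) - 1) / r ^ n - 2 * lam * r) r := by
  obtain ⟨m, rfl⟩ := Nat.exists_eq_add_of_le' hn
  have h1 := ((hasDerivAt_pow m r).fun_inv (pow_ne_zero m hr)).const_mul (2 * M)
  have h2 := (h1.const_sub κ).fun_sub ((hasDerivAt_pow 2 r).const_mul lam)
  refine (h2.congr_deriv ?_).congr_of_eventuallyEq (Filter.Eventually.of_forall fun s => ?_)
  -- At `m = 0` the exponent `m - 1` of the power rule is truncated, but its coefficient vanishes.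
  · rcases m with _ | m
    · simp; ring
    · simp only [Nat.add_sub_cancel]
      push_cast
      field_simp
      ring
  · simp [lapse, div_eq_mul_inv]

theorem contDiffAt_lapse {r : ℝ} (hr : r ≠ 0) (k : WithTop ℕ∞) :
    ContDiffAt ℝ k (lapse n κ M lam) r := by
  unfold lapse
  have : r ^ (n - 1) ≠ 0 := pow_ne_zero _ hr
  fun_prop (disch := assumption)

theorem deriv_lapse (hn : 1 ≤ n) {r : ℝ} (hr : r ≠ 0) :
    deriv (lapse n κ M lam) r = 2 * M * ((n : ℝ) - 1) / r ^ n - 2 * lam * r :=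
  (hasDerivAt_lapse hn hr).deriv

theorem deriv_deriv_lapse (hn : 1 ≤ n) {r : ℝ} (hr : r ≠ 0) :
    deriv (deriv (lapse n κ M lam)) r
      = -(2 * M * ((n : ℝ) - 1) * n / r ^ (n + 1)) - 2 * lam := by
  have h0 : deriv (lapse n κ M lam)
      =ᶠ[nhds r] fun s => 2 * M * ((n : ℝ) - 1) * (s ^ n)⁻¹ - 2 * lam * s := by
    filter_upwards [isOpen_ne.mem_nhds hr] with s hs
    rw [deriv_lapse hn hs, div_eq_mul_inv]
  have h1 := ((hasDerivAt_pow n r).fun_inv (pow_ne_zero n hr)).const_mul (2 * M * ((n : ℝ) - 1))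
  have h2 := h1.fun_sub ((hasDerivAt_id r).const_mul (2 * lam))
  rw [h0.deriv_eq]
  refine h2.deriv.trans ?_
  obtain ⟨m, rfl⟩ := Nat.exists_eq_add_of_le' hn
  simp only [Nat.add_sub_cancel]
  push_cast
  field_simp
  ring

end Lapse

/-- A positive real factor splits off the principal logarithm without a branch correction, whatever
the sign of `D`. The exponent then turns `log r^(-(m+1))` into `log r`. -/
theorem ofReal_div_pow_cpow {D r : ℝ} (hD : D ≠ 0) (hr : 0 < r) (m : ℕ) :
    ((D / r ^ (m + 1) : ℝ) : ℂ) ^ (-1 / ((m : ℂ) + 1)) = (D : ℂ) ^ (-1 / ((m : ℂ) + 1)) * r := by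
  have hp : 0 < (r ^ (m + 1))⁻¹ := by positivity
  have hDc : (D : ℂ) ≠ 0 := by exact_mod_cast hD
  have hm : (m : ℂ) + 1 ≠ 0 := by exact_mod_cast m.succ_ne_zero
  have hrc : (r : ℂ) ≠ 0 := by exact_mod_cast hr.ne'
  rw [div_eq_inv_mul, Complex.ofReal_mul,
    Complex.cpow_def_of_ne_zero (mul_ne_zero (by exact_mod_cast hp.ne') hDc),
    Complex.log_ofReal_mul hp hDc, Complex.cpow_def_of_ne_zero hDc, add_mul, Complex.exp_add,
    mul_comm]
  congr 1
  have hlog : ((Real.log (r ^ (m + 1))⁻¹ : ℝ) : ℂ) * (-1 / ((m : ℂ) + 1)) = (Real.log r : ℝ) := by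
    rw [Real.log_inv, Real.log_pow]
    push_cast
    field_simp
  rw [hlog, ← Complex.ofReal_exp, Real.exp_log hr]

/-! ### The black hole metric as a warped patch, and its Weyl scalar. -/

section BlackHole

variable {n : ℕ} {K : Type*} [TopologicalSpace K] [ChartedSpace (EuclideanSpace ℝ (Fin n)) K]
  [IsManifold (𝓡 n) ∞ K]

theorem sMetric_eq_warpedMetric (gK : RMetric n K) (f : ℝ → ℝ)
    (φ : OpenPartialHomeomorph K (EuclideanSpace ℝ (Fin n))) :
    sMetric gK f φ = warpedMetric f (kMetric gK φ) := by
  have h₁ : ∀ (y : K) (v : TangentSpace (𝓡 n) y), gK.inner y 0 v = 0 := fun y v => by simp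
  have h₂ : ∀ (y : K) (v : TangentSpace (𝓡 n) y), gK.inner y v 0 = 0 := fun y v => by simp
  funext x
  ext a b
  rcases a with a | a <;> rcases b with b | b
  · fin_cases a <;> fin_cases b <;>
      simp [sMetric, warpedMetric, spacetimeMetric, sVec, sPoint] <;> exact Or.inr (h₁ _ _)
  · fin_cases a <;> simp [sMetric, warpedMetric, spacetimeMetric, sVec, sPoint] <;>
      exact Or.inr (h₁ _ _)
  · fin_cases b <;> simp [sMetric, warpedMetric, spacetimeMetric, sVec, sPoint] <;>
      exact Or.inr (h₂ _ _)
  · simp [sMetric, warpedMetric, spacetimeMetric, sVec, sPoint, kMetric]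
    exact Or.inl rfl

theorem isOpen_region {U : Set (ℝ × ℝ)} (hU : IsOpen U)
    (φ : OpenPartialHomeomorph K (EuclideanSpace ℝ (Fin n))) : IsOpen (region U φ) := by
  refine IsOpen.inter (hU.preimage (by fun_prop)) (φ.open_target.preimage ?_)
  exact (PiLp.continuous_toLp 2 _).comp (by fun_prop)

theorem isWarpedPatch_region {κ M lam : ℝ} (gK : RMetric n K) {U : Set (ℝ × ℝ)} (hU : IsOpen U)
    (hpos : ∀ p ∈ U, 0 < p.2 ∧ 0 < lapse n κ M lam p.2)
    {φ : OpenPartialHomeomorph K (EuclideanSpace ℝ (Fin n))}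
    (hφ : φ ∈ IsManifold.maximalAtlas (𝓡 n) ∞ K) :
    IsWarpedPatch (lapse n κ M lam) (kMetric gK φ) (region U φ) where
  isOpen := isOpen_region hU φ
  r_pos _ hx := (hpos _ hx.1).1
  f_pos _ hx := (hpos _ hx.1).2
  contDiffAt_f _ hx := contDiffAt_lapse (hpos _ hx.1).1.ne' 2
  contDiffAt_h _ hx i j := (contDiffAt_kMetric gK hφ hx.2 i j).of_le 
    (WithTop.coe_le_coe.2 (le_top : (2 : ℕ∞) ≤ ⊤))
  symm := kMetric_symm gK φ
  det_ne_zero _ hx := det_kMetric_ne_zero gK hφ hx.2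

theorem TwoForm.comp_antisymm (F : TwoForm n K)
    (φ : OpenPartialHomeomorph K (EuclideanSpace ℝ (Fin n))) (x : Idx n → ℝ) (a b : Idx n) :
    F.comp φ x a b = -F.comp φ x b a := by
  have h := (F (sPoint φ x)).map_swap ![sVec φ x b, sVec φ x a]
    (show (0 : Fin 2) ≠ 1 by decide)
  rw [TwoForm.comp, TwoForm.comp, ← h]
  congr 1
  funext i
  fin_cases i <;> rfl

/-- `Φ = -n (n - 1) M / r^{n+1}`. -/
theorem weylScalar_lapse {κ M lam : ℝ} (hn : 1 ≤ n) {h : (Fin n → ℝ) → Matrix (Fin n) (Fin n) ℝ}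
    {S : Set (Idx n → ℝ)} (H : IsWarpedPatch (lapse n κ M lam) h S) {x : Idx n → ℝ} (hx : x ∈ S)
    (hE : ∀ i j, ricci h (ang x) i j = κ * ((n : ℝ) - 1) * h (ang x) i j) :
    weylScalar (warpedMetric (lapse n κ M lam) h) (nullL (lapse n κ M lam))
      (nullK (lapse n κ M lam)) x
      = -((n : ℝ) * (n - 1) * M) / x (Sum.inl 1) ^ (n + 1) := by
  have hr := H.r_ne hx
  -- The Einstein constant `κ(n-1)` is the one for which `κ` cancels in `c - (n-1) f`; the `λ` terms
  -- cancel because they describe constant curvature. Only `M` remains.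
  rw [H.weylScalar_eq hx hE (by omega), deriv_lapse hn hr, deriv_deriv_lapse hn hr, lapse]
  obtain ⟨m, rfl⟩ := Nat.exists_eq_add_of_le' hn
  have hm : (m : ℝ) + 1 ≠ 0 := by positivity
  have hm2 : (m : ℝ) + 1 + 1 ≠ 0 := by positivity
  simp only [Nat.add_sub_cancel]
  push_cast
  field_simp
  ring

end BlackHole

end StaticBH

end

open StaticBH in
theorem mainTheorem4 (n : ℕ) (hn : 2 ≤ n)
    {K : Type*} [TopologicalSpace K] [ChartedSpace (EuclideanSpace ℝ (Fin n)) K]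
    [IsManifold (𝓡 n) ∞ K]
    (κ M lam : ℝ) (hM : M ≠ 0)
    (gK : StaticBH.RMetric n K) (hK : StaticBH.IsEinstein gK (κ * ((n : ℝ) - 1)))
    (f : ℝ → ℝ) (hf : f = StaticBH.lapse n κ M lam)
    (U : Set (ℝ × ℝ)) (hU : IsOpen U) (hpos : ∀ p ∈ U, 0 < p.2 ∧ 0 < f p.2)
    (F : StaticBH.TwoForm n K) (hF : F.IsC2On U)
    (φ : OpenPartialHomeomorph K (EuclideanSpace ℝ (Fin n)))
    (hφ : φ ∈ IsManifold.maximalAtlas (𝓡 n) ∞ K)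
    (g : (StaticBH.Idx n → ℝ) → Matrix (StaticBH.Idx n) (StaticBH.Idx n) ℝ)
    (hg : g = StaticBH.sMetric gK f φ)
    (l k : (StaticBH.Idx n → ℝ) → StaticBH.Idx n → ℝ)
    (hl : l = StaticBH.nullL f) (hk : k = StaticBH.nullK f)
    (x : StaticBH.Idx n → ℝ) (hx : x ∈ StaticBH.region U φ) :
    -StaticBH.contract g (StaticBH.ckyForm g l k)
        (StaticBH.modLaplaceDeRham 1 g (StaticBH.gammaForm g l k) (F.comp φ)) x =
      StaticBH.box g (StaticBH.contract g (StaticBH.ckyForm g l k) (F.comp φ)) x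
        + ((StaticBH.potential n (StaticBH.weylScalar g l k x) (StaticBH.cosmConst n lam) : ℝ) : ℂ)
          * StaticBH.contract g (StaticBH.ckyForm g l k) (F.comp φ) x := by
  subst hf hg hl hk
  have H := isWarpedPatch_region gK hU hpos hφ
  rw [sMetric_eq_warpedMetric]
  have hE : ∀ z ∈ region U φ, ∀ i j, ricci (kMetric gK φ) (ang z) i j
      = κ * ((n : ℝ) - 1) * kMetric gK φ (ang z) i j := fun z hz => hK φ hφ (ang z) hz.2
  have hΦ := fun z hz => weylScalar_lapse (by omega) H hz (hE z hz)
  have hn1 : (n : ℝ) - 1 ≠ 0 := by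
    have : (2 : ℝ) ≤ n := by exact_mod_cast hn
    linarith
  have hn0 : (n : ℝ) ≠ 0 := by positivity
  -- Here `n ≥ 2` and `M ≠ 0` matter: `Φ` has no zero, so its complex power can be split.
  have hD : -((n : ℝ) * (n - 1) * M) ≠ 0 :=
    neg_ne_zero.2 (mul_ne_zero (mul_ne_zero hn0 hn1) hM)
  have hw := F.comp_antisymm φ
  have hC : ∀ z ∈ region U φ, ∀ a b, ContDiffAt ℝ 2 (fun z => F.comp φ z a b) z :=
    fun z hz a b => (hF φ hφ a b).contDiffAt (H.isOpen.mem_nhds hz)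
  have hmain := H.r_smul_modLaplaceDeRham_tr hx (fun a => H.gammaForm_eq hx (by omega) a) hw hC
  set Q : ℂ := ((-((n : ℝ) * (n - 1) * M) : ℝ) : ℂ) ^ (-1 / ((n : ℂ) + 1)) with hQ
  -- Needed on the whole open region and not only at `x`, because the wave operator differentiates
  -- the contraction.
  have hcon : ∀ B : (Idx n → ℝ) → Idx n → Idx n → ℂ, (∀ z a b, B z a b = -B z b a) →
      ∀ z ∈ region U φ, contract (warpedMetric (lapse n κ M lam) (kMetric gK φ))
        (ckyForm (warpedMetric (lapse n κ M lam) (kMetric gK φ)) (nullL (lapse n κ M lam))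
          (nullK (lapse n κ M lam))) B z
        = 2 * Q * (z (Sum.inl 1) • B z (Sum.inl 0) (Sum.inl 1)) := by
    intro B hB z hz
    rw [H.contract_ckyForm hz, hΦ z hz, ofReal_div_pow_cpow hD (H.r_pos z hz), ← hQ,
      hB z (Sum.inl 1), Complex.real_smul]
    ring
  have hu : ∀ z ∈ region U φ,
      ContDiffAt ℝ 2 (fun z => z (Sum.inl 1) • F.comp φ z (Sum.inl 0) (Sum.inl 1)) z :=
    fun z hz => ContDiffAt.smul (f := fun z : Idx n → ℝ => z (Sum.inl 1)) (by fun_prop) (hC z hz _ _)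
  -- Since `2Λ/(n+1) = nλ`, the bracket `Φ + nλ` equals `-n f'/(2r)`.
  have hV : potential n (weylScalar (warpedMetric (lapse n κ M lam) (kMetric gK φ))
      (nullL (lapse n κ M lam)) (nullK (lapse n κ M lam)) x) (cosmConst n lam)
      = ((n : ℝ) - 1) * deriv (lapse n κ M lam) (x (Sum.inl 1)) / x (Sum.inl 1) := by
    have hr := H.r_ne hx
    have hn2 : (n : ℝ) + 1 ≠ 0 := by positivity
    rw [hΦ x hx, deriv_lapse (by omega) hr, potential, cosmConst]
    field_simp
    ring
  rw [hcon _ (modLaplaceDeRham_antisymm (warpedMetric_symm _ (kMetric_symm gK φ)) 1 _ hw) x hx,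
    box_congr_on H.isOpen (hcon _ hw) hx, box_const_mul H.isOpen hu _ hx, hcon _ hw x hx, hV]
  simp only [Complex.real_smul] at hmain ⊢
  linear_combination 2 * Q * hmain
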